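/- For complex numbers $s,t,r$ let $$M_{s,t,r}=\partial\bar\partial-s\,z\,\partial-t\,\bar z\,\bar\partial-r,\qquad \partial=\tfrac12(\partial_x-i\partial_y),\quad \bar\partial=\tfrac12(\partial_x+i\partial_y),$$ let $(x,y)_k=x(x+y)\cdots(x+(k-1)y)$, $(x,y)_0=1$, $(x)_k=(x,1)_k$, and put $$\mathcal P(\alpha,\beta|\gamma;z)=\sum_{k=0}^{\infty}\frac{(\alpha,\beta)_k}{(\gamma)_k}\frac{z^k}{k!}.$$ Let $u$ be a complex-valued $C^2$ function on the open unit disc $\mathbb D$ with $M_{s,t,r}u=0$ in $\mathbb D$. Then $u\in C^\infty(\mathbb D)$ and $$u(z)=\sum_{m=0}^{\infty}\frac{\partial^m u(0)}{m!}\,\mathcal P(r+sm,s+t\,|\,m+1;|z|^2)\,z^m+\sum_{m=1}^{\infty}\frac{\bar\partial^m u(0)}{m!}\,\mathcal P(r+tm,t+s\,|\,m+1;|z|^2)\,\bar z^m,\qquad z\in\mathbb D.$$ Both series converge absolutely at every point of $\mathbb D$, and absolutely in $C^\infty(\mathbb D)$: writing $u_m$ for the term of index $m$ in either series, $\sum_m\sup_{K}|\partial^j\bar\partial^k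 u_m|<\infty$ for all $j,k\ge 0$ and all compact $K\subset\mathbb D$. In particular, if $s=t=0$ (the Helmholtz equation $\partial\bar\partial u-ru=0$), then for $z\in\mathbb D$ $$u(z)=\sum_{m=1}^{\infty}\sum_{n=0}^{\infty}\frac{z^m\partial^m u(0)+\bar z^m\bar\partial^m u(0)}{(m+n)!}\,\frac{r^n|z|^{2n}}{n!}+\sum_{n=0}^{\infty}\frac{u(0)}{n!}\frac{r^n|z|^{2n}}{n!},$$ with an absolutely convergent double series and an absolutely convergent single series, and if $s=t=r=0$ (the Laplace equation), then for $z\in\mathbb D$ $$u(z)=\sum_{m=1}^{\infty}\frac{z^m\partial^m u(0)+\bar z^m\bar\partial^m u(0)}{m!}+u(0),$$ with an absolutely convergent series. -/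

import Mathlib

open scoped ContDiff Nat ComplexConjugate

noncomputable section

namespace GenHarmonic

/-- The open unit disc of the complex plane. -/
def disc : Set ℂ := Metric.ball 0 1

/-- The complex derivative `∂ = (∂/∂x - i ∂/∂y) / 2`. -/
def dz (f : ℂ → ℂ) (z : ℂ) : ℂ :=
  (fderiv ℝ f z 1 - Complex.I * fderiv ℝ f z Complex.I) / 2

/-- The complex derivative `∂̄ = (∂/∂x + i ∂/∂y) / 2`. -/
def dzbar (f : ℂ → ℂ) (z : ℂ) : ℂ :=
  (fderiv ℝ f z 1 + Complex.I * fderiv ℝ f z Complex.I) / 2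

/-- The operator `M_{s,t,r} = ∂∂̄ - s z ∂ - t z̄ ∂̄ - r`. -/
def M (s t r : ℂ) (u : ℂ → ℂ) (z : ℂ) : ℂ :=
  dz (dzbar u) z - s * z * dz u z - t * conj z * dzbar u z - r * u z

/-- `u` is a solution on the unit disc: it is of class `C²` there and `M_{s,t,r} u = 0`. -/
structure IsSolution (s t r : ℂ) (u : ℂ → ℂ) : Prop where
  contDiffOn : ContDiffOn ℝ 2 u disc
  eq_zero : ∀ z ∈ disc, M s t r u z = 0

/-- The generalised Pochhammer symbol `(x, y)_n = x (x + y) ⋯ (x + (n - 1) y)`. -/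
def poch (x y : ℂ) (n : ℕ) : ℂ := ∏ i ∈ Finset.range n, (x + i * y)

/-- `𝒫(α, β | γ; z) = ∑ k, (α, β)_k / (γ)_k * z ^ k / k!`, where `(γ)_k = (γ, 1)_k`.
It is used for `γ = 1, 2, 3, …`, where the series converges absolutely for all `z`. -/
def P (α β γ z : ℂ) : ℂ := ∑' k : ℕ, poch α β k / poch γ 1 k * (z ^ k / (k ! : ℂ))

/-- The term of weight `m` of the expansion of `u`. -/
def holTerm (s t r : ℂ) (u : ℂ → ℂ) (m : ℕ) (z : ℂ) : ℂ :=
  (dz^[m] u 0) / (m ! : ℂ) * P (r + s * m) (s + t) (m + 1) ((‖z‖ ^ 2 : ℝ) : ℂ) * z ^ m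

/-- The term of weight `-m` of the expansion of `u`. -/
def antiholTerm (s t r : ℂ) (u : ℂ → ℂ) (m : ℕ) (z : ℂ) : ℂ :=
  (dzbar^[m] u 0) / (m ! : ℂ) * P (r + t * m) (t + s) (m + 1) ((‖z‖ ^ 2 : ℝ) : ℂ)
    * (conj z) ^ m

/-- The seminorm `‖f‖_{j,k,K} = sup_K |∂^j ∂̄^k f|`. For `K` running over the compact subsets of
the disc these define the topology of `C^∞` of the disc. -/
def seminormOn (j k : ℕ) (K : Set ℂ) (f : ℂ → ℂ) : ℝ :=
  sSup ((fun z => ‖dz^[j] (dzbar^[k] f) z‖) '' K)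

end GenHarmonic

end

/-!
On the circle of radius `ρ`, let `f(ρ)` be the `n`-th Laurent coefficient of a solution `u` and
`g(ρ)` the `(n + 1)`-st one of `∂̄u`. The equation turns into a linear first order system for
`(f, g)` on `0 < ρ < 1`, singular at `0`. One solution comes from
`𝒫(r + s n⁺ + t n⁻, s + t | |n| + 1; |z|²) z^{n⁺} z̄^{n⁻}`, and it is the only one up to a scalar:
the Wronskian `W` of two solutions that come from `C²` functions makes `ρ^{2n+2} e^{-(s+t)ρ²} W`
constant, and this tends to `0` with `ρ`. Hence `f` is a multiple `cₙ` of the explicit solution.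

Since `𝒫(r + s m, s + t | m + 1; x) → e^{s x}` as `m → ∞`, and similarly for `t`, the bound of the
Laurent coefficients by `sup |u|` on a circle of radius `R < 1` gives `cₙ = O(R^{-|n|})`. So `u` is
the sum of a power series in `z` and `z̄` that converges absolutely in the disc together with all
its derivatives, and the `cₙ` are read off from the derivatives at the origin.
-/

noncomputable section

namespace GenHarmonic

open Set Filter MeasureTheory
open scoped Topology

section Wirtinger

/-! ### Wirtinger derivatives -/

/-- The real-linear map `w ↦ p * w + q * conj w`: the real differential of a function whose
Wirtinger derivatives `∂` and `∂̄` are `p` and `q`. -/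
def wirtingerCLM (p q : ℂ) : ℂ →L[ℝ] ℂ :=
  p • ContinuousLinearMap.id ℝ ℂ + q • (Complex.conjCLE : ℂ →L[ℝ] ℂ)

lemma wirtingerCLM_apply (p q w : ℂ) : wirtingerCLM p q w = p * w + q * conj w := by
  simp [wirtingerCLM]

lemma norm_wirtingerCLM_le (p q : ℂ) : ‖wirtingerCLM p q‖ ≤ ‖p‖ + ‖q‖ := by
  refine ContinuousLinearMap.opNorm_le_bound _ (by positivity) fun w => ?_
  rw [wirtingerCLM_apply]
  exact (norm_add_le _ _).trans_eq (by simp [add_mul])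

variable {f g : ℂ → ℂ} {p q z : ℂ} {U : Set ℂ}

lemma dz_eq_of_hasFDerivAt (h : HasFDerivAt f (wirtingerCLM p q) z) : dz f z = p := by
  simp only [dz, h.fderiv, wirtingerCLM_apply, map_one, Complex.conj_I]
  linear_combination (-(p - q) / 2) * Complex.I_mul_I

lemma dzbar_eq_of_hasFDerivAt (h : HasFDerivAt f (wirtingerCLM p q) z) : dzbar f z = q := by
  simp only [dzbar, h.fderiv, wirtingerCLM_apply, map_one, Complex.conj_I]
  linear_combination ((p - q) / 2) * Complex.I_mul_I

lemma fderiv_apply_eq_dz_dzbar (f : ℂ → ℂ) (z w : ℂ) :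
    fderiv ℝ f z w = dz f z * w + dzbar f z * conj w := by
  have hw : fderiv ℝ f z w = w.re * fderiv ℝ f z 1 + w.im * fderiv ℝ f z Complex.I := by
    rw [← Complex.real_smul, ← Complex.real_smul, ← map_smul, ← map_smul, ← map_add]
    simp [Complex.re_add_im]
  have hconj : conj w = w.re - w.im * Complex.I := by
    simp [Complex.ext_iff]
  rw [hw, dz, dzbar, hconj]
  linear_combination (w.im * fderiv ℝ f z Complex.I) * Complex.I_mul_I +
    (fderiv ℝ f z 1 - Complex.I * fderiv ℝ f z Complex.I) / 2 * Complex.re_add_im w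

lemma dz_eqOn (hU : IsOpen U) (h : EqOn f g U) : EqOn (dz f) (dz g) U := fun z hz => by
  simp only [dz, (h.eventuallyEq_of_mem (hU.mem_nhds hz)).fderiv_eq]

lemma dzbar_eqOn (hU : IsOpen U) (h : EqOn f g U) : EqOn (dzbar f) (dzbar g) U := fun z hz => by
  simp only [dzbar, (h.eventuallyEq_of_mem (hU.mem_nhds hz)).fderiv_eq]

lemma iterate_dz_eqOn (hU : IsOpen U) (h : EqOn f g U) (n : ℕ) :
    EqOn (dz^[n] f) (dz^[n] g) U := by
  induction n with
  | zero => exact h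
  | succ n ih => simpa only [Function.iterate_succ_apply'] using dz_eqOn hU ih

lemma iterate_dzbar_eqOn (hU : IsOpen U) (h : EqOn f g U) (n : ℕ) :
    EqOn (dzbar^[n] f) (dzbar^[n] g) U := by
  induction n with
  | zero => exact h
  | succ n ih => simpa only [Function.iterate_succ_apply'] using dzbar_eqOn hU ih

lemma contDiffOn_dz {n : ℕ∞ω} (hU : IsOpen U) (hf : ContDiffOn ℝ (n + 1) f U) :
    ContDiffOn ℝ n (dz f) U := by
  have h := hf.fderiv_of_isOpen hU le_rfl
  exact ((h.clm_apply contDiffOn_const).sub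
    (contDiffOn_const.mul (h.clm_apply contDiffOn_const))).div_const 2

lemma contDiffOn_dzbar {n : ℕ∞ω} (hU : IsOpen U) (hf : ContDiffOn ℝ (n + 1) f U) :
    ContDiffOn ℝ n (dzbar f) U := by
  have h := hf.fderiv_of_isOpen hU le_rfl
  exact ((h.clm_apply contDiffOn_const).add
    (contDiffOn_const.mul (h.clm_apply contDiffOn_const))).div_const 2

lemma hasFDerivAt_monomial (c : ℂ) (j k : ℕ) (z : ℂ) :
    HasFDerivAt (𝕜 := ℝ) (fun z : ℂ => c * z ^ j * conj z ^ k)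
      (wirtingerCLM (j * c * z ^ (j - 1) * conj z ^ k) (k * c * z ^ j * conj z ^ (k - 1))) z := by
  have hz := (hasDerivAt_pow j z).hasFDerivAt.restrictScalars ℝ
  have hconj := ((hasDerivAt_pow k (conj z)).hasFDerivAt.restrictScalars ℝ).comp z
    (Complex.conjCLE : ℂ →L[ℝ] ℂ).hasFDerivAt
  convert! (hz.const_mul c).mul hconj using 1
  ext
  simp only [wirtingerCLM_apply, Function.comp_apply, add_apply, smul_apply,
    ContinuousLinearMap.comp_apply, ContinuousLinearEquiv.coe_coe,
    ContinuousAlgEquiv.coeCLE_apply, Complex.conjCAE_apply,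
    ContinuousLinearMap.coe_restrictScalars', ContinuousLinearMap.toSpanSingleton_apply,
    smul_eq_mul]
  ring

end Wirtinger

section Biseries

/-! ### Power series in `z` and `conj z` -/

/-- The series `∑ i, a i * z ^ α i * conj z ^ β i`, over an arbitrary index type. -/
def biseries {ι : Type*} (a : ι → ℂ) (α β : ι → ℕ) (z : ℂ) : ℂ :=
  ∑' i, a i * z ^ α i * conj z ^ β i

/-- The series `biseries a α β` converges absolutely in the open disc of radius `R`, that is, at
the points of every circle of smaller radius. -/
def AbsConv {ι : Type*} (R : ℝ) (a : ι → ℂ) (α β : ι → ℕ) : Prop :=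
  ∀ ρ : ℝ, 0 < ρ → ρ < R → Summable fun i => ‖a i‖ * ρ ^ (α i + β i)

variable {ι : Type*} {a : ι → ℂ} {α β : ι → ℕ} {R ρ : ℝ} {z : ℂ} {K : Set ℂ}

lemma norm_monomial_le (hz : ‖z‖ ≤ ρ) (c : ℂ) (j k : ℕ) :
    ‖c * z ^ j * conj z ^ k‖ ≤ ‖c‖ * ρ ^ (j + k) := by
  rw [norm_mul, norm_mul, norm_pow, norm_pow, Complex.norm_conj, mul_assoc, ← pow_add]
  gcongr

lemma natCast_mul_pow_pred_mul_sub_le (hρ : 0 ≤ ρ) (h : ρ ≤ R) (n : ℕ) :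
    n * ρ ^ (n - 1) * (R - ρ) ≤ R ^ n := by
  induction n with
  | zero => simp
  | succ n ih =>
    have hpow : ρ * (n * ρ ^ (n - 1)) = n * ρ ^ n := by cases n with
      | zero => simp
      | succ n => rw [Nat.add_sub_cancel, pow_succ]; ring
    calc ((n + 1 : ℕ) : ℝ) * ρ ^ (n + 1 - 1) * (R - ρ)
        = ρ * (n * ρ ^ (n - 1) * (R - ρ)) + ρ ^ n * (R - ρ) := by
          rw [← mul_assoc ρ, hpow]; push_cast; ring
      _ ≤ ρ * R ^ n + R ^ n * (R - ρ) := by gcongr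
      _ = R ^ (n + 1) := by ring

namespace AbsConv

lemma summable_norm (h : AbsConv R a α β) (hz : z ∈ Metric.ball 0 R) :
    Summable fun i => ‖a i * z ^ α i * conj z ^ β i‖ := by
  obtain ⟨ρ, hzρ, hρ⟩ := exists_between (mem_ball_zero_iff.1 hz)
  exact Summable.of_nonneg_of_le (fun _ => norm_nonneg _)
    (fun i => norm_monomial_le hzρ.le _ _ _) (h ρ ((norm_nonneg _).trans_lt hzρ) hρ)

lemma summable (h : AbsConv R a α β) (hz : z ∈ Metric.ball 0 R) :
    Summable fun i => a i * z ^ α i * conj z ^ β i := (h.summable_norm hz).of_norm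

lemma swap (h : AbsConv R a α β) : AbsConv R a β α := fun ρ h0 h1 => by
  simpa only [add_comm] using h ρ h0 h1

lemma deriv_left (h : AbsConv R a α β) :
    AbsConv R (fun i => α i * a i) (fun i => α i - 1) β := by
  intro ρ h0 h1
  obtain ⟨σ, hρσ, hσ⟩ := exists_between h1
  have hpow (n : ℕ) : n * ρ ^ (n - 1) ≤ (σ - ρ)⁻¹ * σ ^ n := by
    rw [inv_mul_eq_div, le_div_iff₀ (sub_pos.2 hρσ)]
    exact natCast_mul_pow_pred_mul_sub_le h0.le hρσ.le n
  refine Summable.of_nonneg_of_le (fun _ => by positivity) (fun i => ?_)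
    ((h σ (h0.trans hρσ) hσ).mul_left (σ - ρ)⁻¹)
  calc ‖(α i : ℂ) * a i‖ * ρ ^ (α i - 1 + β i)
      = ‖a i‖ * (α i * ρ ^ (α i - 1)) * ρ ^ β i := by
        rw [norm_mul, Complex.norm_natCast, pow_add]; ring
    _ ≤ ‖a i‖ * ((σ - ρ)⁻¹ * σ ^ α i) * σ ^ β i := by
        have := (by positivity : 0 ≤ α i * ρ ^ (α i - 1)).trans (hpow (α i))
        have := hpow (α i)
        gcongr
    _ = (σ - ρ)⁻¹ * (‖a i‖ * σ ^ (α i + β i)) := by rw [pow_add]; ring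

lemma deriv_right (h : AbsConv R a α β) :
    AbsConv R (fun i => β i * a i) α (fun i => β i - 1) := h.swap.deriv_left.swap

lemma iterate_deriv_left (h : AbsConv R a α β) (n : ℕ) :
    AbsConv R (fun i => (α i).descFactorial n * a i) (fun i => α i - n) β := by
  induction n with
  | zero => simpa using h
  | succ n ih => simpa [Nat.descFactorial_succ, mul_assoc, Nat.sub_sub] using ih.deriv_left

lemma iterate_deriv_right (h : AbsConv R a α β) (n : ℕ) :
    AbsConv R (fun i => (β i).descFactorial n * a i) α (fun i => β i - n) :=
  (h.swap.iterate_deriv_left n).swap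

lemma hasFDerivAt (h : AbsConv R a α β) (hz : z ∈ Metric.ball 0 R) :
    HasFDerivAt (𝕜 := ℝ) (biseries a α β)
      (wirtingerCLM (biseries (fun i => α i * a i) (fun i => α i - 1) β z)
        (biseries (fun i => β i * a i) α (fun i => β i - 1) z)) z := by
  obtain ⟨ρ, hzρ, hρ⟩ := exists_between (mem_ball_zero_iff.1 hz)
  have h0 : 0 < ρ := (norm_nonneg _).trans_lt hzρ
  have hbound (i : ι) (w : ℂ) (hw : w ∈ Metric.ball 0 ρ) :=
    (norm_wirtingerCLM_le _ _).trans (add_le_add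
      (norm_monomial_le (mem_ball_zero_iff.1 hw).le (α i * a i) (α i - 1) (β i))
      (norm_monomial_le (mem_ball_zero_iff.1 hw).le (β i * a i) (α i) (β i - 1)))
  have hsum := hasFDerivAt_tsum_of_isPreconnected (𝕜 := ℝ)
    ((h.deriv_left ρ h0 hρ).add (h.deriv_right ρ h0 hρ)) Metric.isOpen_ball
    (convex_ball _ _).isPreconnected (fun i w _ => hasFDerivAt_monomial (a i) (α i) (β i) w)
    hbound (mem_ball_zero_iff.2 hzρ) (h.summable hz) (mem_ball_zero_iff.2 hzρ)
  convert! hsum using 1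
  have hleft := h.deriv_left.summable hz
  have hright := h.deriv_right.summable hz
  simp only [wirtingerCLM]
  rw [Summable.tsum_add (hleft.smul_const _) (hright.smul_const _), hleft.tsum_smul_const,
    hright.tsum_smul_const]
  rfl

lemma dz_biseries (h : AbsConv R a α β) (hz : z ∈ Metric.ball 0 R) :
    dz (biseries a α β) z = biseries (fun i => α i * a i) (fun i => α i - 1) β z :=
  dz_eq_of_hasFDerivAt (h.hasFDerivAt hz)

lemma dzbar_biseries (h : AbsConv R a α β) (hz : z ∈ Metric.ball 0 R) :
    dzbar (biseries a α β) z = biseries (fun i => β i * a i) α (fun i => β i - 1) z :=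
  dzbar_eq_of_hasFDerivAt (h.hasFDerivAt hz)

lemma contDiffOn_natCast (h : AbsConv R a α β) (n : ℕ) :
    ContDiffOn ℝ n (biseries a α β) (Metric.ball 0 R) := by
  induction n generalizing a α β with
  | zero => exact contDiffOn_zero.2 fun z hz => (h.hasFDerivAt hz).continuousAt.continuousWithinAt
  | succ n ih =>
    push_cast
    refine (contDiffOn_succ_iff_fderiv_of_isOpen Metric.isOpen_ball).2
      ⟨fun z hz => (h.hasFDerivAt hz).differentiableAt.differentiableWithinAt, by simp, ?_⟩
    refine ContDiffOn.congr ?_ fun z hz => (h.hasFDerivAt hz).fderiv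
    exact ((ih h.deriv_left).smul contDiffOn_const).add ((ih h.deriv_right).smul contDiffOn_const)

lemma contDiffOn (h : AbsConv R a α β) : ContDiffOn ℝ ∞ (biseries a α β) (Metric.ball 0 R) :=
  contDiffOn_infty.2 h.contDiffOn_natCast

lemma iterate_dz (h : AbsConv R a α β) (n : ℕ) :
    EqOn (dz^[n] (biseries a α β))
      (biseries (fun i => (α i).descFactorial n * a i) (fun i => α i - n) β)
      (Metric.ball 0 R) := by
  induction n with
  | zero => intro z _; simp
  | succ n ih =>
    intro z hz
    rw [Function.iterate_succ_apply', dz_eqOn Metric.isOpen_ball ih hz,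
      (h.iterate_deriv_left n).dz_biseries hz]
    simp only [Nat.descFactorial_succ, Nat.cast_mul, mul_assoc, Nat.sub_sub]

lemma iterate_dzbar (h : AbsConv R a α β) (n : ℕ) :
    EqOn (dzbar^[n] (biseries a α β))
      (biseries (fun i => (β i).descFactorial n * a i) α (fun i => β i - n))
      (Metric.ball 0 R) := by
  induction n with
  | zero => intro z _; simp
  | succ n ih =>
    intro z hz
    rw [Function.iterate_succ_apply', dzbar_eqOn Metric.isOpen_ball ih hz,
      (h.iterate_deriv_right n).dzbar_biseries hz]
    simp only [Nat.descFactorial_succ, Nat.cast_mul, mul_assoc, Nat.sub_sub]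

lemma iterate_dz_iterate_dzbar (h : AbsConv R a α β) (j k : ℕ) :
    EqOn (dz^[j] (dzbar^[k] (biseries a α β)))
      (biseries (fun i => (α i).descFactorial j * ((β i).descFactorial k * a i))
        (fun i => α i - j) fun i => β i - k) (Metric.ball 0 R) :=
  (iterate_dz_eqOn Metric.isOpen_ball (h.iterate_dzbar k) j).trans
    ((h.iterate_deriv_right k).iterate_dz j)

lemma iterate_dz_iterate_dzbar_zero (h : AbsConv R a α β) (hR : 0 < R) (i : ι)
    (hi : ∀ i' ≠ i, ¬(α i' = α i ∧ β i' = β i)) :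
    dz^[α i] (dzbar^[β i] (biseries a α β)) 0 = (α i)! * ((β i)! * a i) := by
  rw [h.iterate_dz_iterate_dzbar _ _ (Metric.mem_ball_self hR), biseries, tsum_eq_single i]
  · simp [Nat.descFactorial_self]
  · intro i' hi'
    rcases lt_trichotomy (α i') (α i) with hα | hα | hα
    · simp [Nat.descFactorial_of_lt hα]
    · rcases lt_trichotomy (β i') (β i) with hβ | hβ | hβ
      · simp [Nat.descFactorial_of_lt hβ]
      · exact absurd ⟨hα, hβ⟩ (hi i' hi')
      · simp [Nat.sub_ne_zero_of_lt hβ]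
    · simp [Nat.sub_ne_zero_of_lt hα]

lemma hasSum_prod {κ : Type*} {a : κ × ι → ℂ} {α β : κ × ι → ℕ} (h : AbsConv R a α β)
    (hz : z ∈ Metric.ball 0 R) :
    HasSum (fun m => biseries (fun i => a (m, i)) (fun i => α (m, i)) (fun i => β (m, i)) z)
      (biseries a α β z) :=
  (h.summable hz).hasSum.prod_fiberwise fun m => ((h.summable hz).prod_factor m).hasSum

lemma hasSum_mul_dz (h : AbsConv R a α β) (hz : z ∈ Metric.ball 0 R) :
    HasSum (fun i => α i * (a i * z ^ α i * conj z ^ β i)) (z * dz (biseries a α β) z) := by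
  rw [h.dz_biseries hz]
  refine ((h.deriv_left.summable hz).hasSum.mul_left z).congr_fun fun i => ?_
  rcases α i with _ | n
  · simp
  · rw [Nat.add_sub_cancel]; ring

lemma hasSum_conj_mul_dzbar (h : AbsConv R a α β) (hz : z ∈ Metric.ball 0 R) :
    HasSum (fun i => β i * (a i * z ^ α i * conj z ^ β i))
      (conj z * dzbar (biseries a α β) z) := by
  rw [h.dzbar_biseries hz]
  refine ((h.deriv_right.summable hz).hasSum.mul_left (conj z)).congr_fun fun i => ?_
  rcases β i with _ | n
  · simp
  · rw [Nat.add_sub_cancel]; ring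

lemma hasSum_dz_dzbar (h : AbsConv R a α β) (hz : z ∈ Metric.ball 0 R) :
    HasSum (fun i => α i * (β i * a i) * z ^ (α i - 1) * conj z ^ (β i - 1))
      (dz (dzbar (biseries a α β)) z) := by
  rw [dz_eqOn Metric.isOpen_ball (fun _ => h.dzbar_biseries) hz, h.deriv_right.dz_biseries hz]
  exact (h.deriv_right.deriv_left.summable hz).hasSum

end AbsConv

lemma biseries_const_mul (c : ℂ) (a : ι → ℂ) (α β : ι → ℕ) (z : ℂ) :
    biseries (fun i => c * a i) α β z = c * biseries a α β z := by
  simp only [biseries, mul_assoc, tsum_mul_left]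

lemma exists_forall_norm_le_of_subset_ball (hR : 0 < R) (hK : IsCompact K)
    (hKR : K ⊆ Metric.ball 0 R) : ∃ ρ, 0 < ρ ∧ ρ < R ∧ ∀ z ∈ K, ‖z‖ ≤ ρ := by
  obtain ⟨ρ, hρ, hKρ⟩ := exists_pos_lt_subset_ball hR hK.isClosed hKR
  exact ⟨ρ, hρ.1, hρ.2, fun z hz => (mem_ball_zero_iff.1 (hKρ hz)).le⟩

lemma seminormOn_nonneg (j k : ℕ) (K : Set ℂ) (f : ℂ → ℂ) : 0 ≤ seminormOn j k K f :=
  Real.sSup_nonneg (by rintro _ ⟨z, _, rfl⟩; exact norm_nonneg _)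

lemma AbsConv.seminormOn_le (h : AbsConv R a α β) {f : ℂ → ℂ}
    (hf : EqOn f (biseries a α β) (Metric.ball 0 R)) (h0 : 0 < ρ) (h1 : ρ < R)
    (hK : ∀ z ∈ K, ‖z‖ ≤ ρ) (j k : ℕ) :
    seminormOn j k K f ≤ ∑' i, ‖((α i).descFactorial j * ((β i).descFactorial k * a i) : ℂ)‖ *
      ρ ^ (α i - j + (β i - k)) := by
  refine Real.sSup_le ?_ (tsum_nonneg fun _ => by positivity)
  rintro _ ⟨z, hz, rfl⟩
  have hzR : z ∈ Metric.ball 0 R := mem_ball_zero_iff.2 ((hK z hz).trans_lt h1)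
  change ‖dz^[j] (dzbar^[k] f) z‖ ≤ _
  rw [iterate_dz_eqOn Metric.isOpen_ball (iterate_dzbar_eqOn Metric.isOpen_ball hf k) j hzR,
    h.iterate_dz_iterate_dzbar j k hzR]
  exact tsum_of_norm_bounded (((h.iterate_deriv_right k).iterate_deriv_left j) ρ h0 h1).hasSum
    fun i => norm_monomial_le (hK z hz) _ _ _

lemma AbsConv.summable_seminormOn {κ : Type*} {a : κ × ι → ℂ} {α β : κ × ι → ℕ}
    (h : AbsConv R a α β) {f : κ → ℂ → ℂ}
    (hf : ∀ m, EqOn (f m) (biseries (fun i => a (m, i)) (fun i => α (m, i)) fun i => β (m, i))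
      (Metric.ball 0 R))
    (hR : 0 < R) (hK : IsCompact K) (hKR : K ⊆ Metric.ball 0 R) (j k : ℕ) :
    Summable fun m => seminormOn j k K (f m) := by
  obtain ⟨ρ, h0, h1, hρ⟩ := exists_forall_norm_le_of_subset_ball hR hK hKR
  have hm (m : κ) : AbsConv R (fun i => a (m, i)) (fun i => α (m, i)) fun i => β (m, i) :=
    fun ρ h0 h1 => (h ρ h0 h1).prod_factor m
  exact Summable.of_nonneg_of_le (fun _ => seminormOn_nonneg _ _ _ _)
    (fun m => (hm m).seminormOn_le (hf m) h0 h1 hρ j k)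
    (((h.iterate_deriv_right k).iterate_deriv_left j) ρ h0 h1).prod

end Biseries

section CircleAverage

/-! ### Circle averages and Laurent coefficients -/

open Real (circleAverage)

section

variable {E : Type*} [NormedAddCommGroup E] [NormedSpace ℝ E] {g : ℂ → E}
  {U : Set ℂ} {c : ℂ} {ρ : ℝ}

lemma hasDerivAt_circleMap_radius (c : ℂ) (x θ : ℝ) :
    HasDerivAt (fun x => circleMap c x θ) (circleMap 0 1 θ) x := by
  simpa [circleMap] using!
    (((Complex.ofRealCLM.hasDerivAt (x := x)).mul_const (Complex.exp (θ * Complex.I))).const_add c)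

lemma hasDerivAt_circleAverage (hU : IsOpen U) (hg : ContDiffOn ℝ 1 g U)
    (hρU : Metric.sphere c |ρ| ⊆ U) (hρ : ρ ≠ 0) :
    HasDerivAt (circleAverage g c)
      (ρ⁻¹ • circleAverage (fun z => fderiv ℝ g z (z - c)) c ρ) ρ := by
  have hg' := hg.continuousOn_fderiv_of_isOpen hU le_rfl
  obtain ⟨δ, hδ, hδU⟩ := (isCompact_sphere c |ρ|).exists_cthickening_subset_open hU hρU
  have hmem : ∀ x ∈ Metric.ball ρ δ, ∀ θ,
      circleMap c x θ ∈ Metric.cthickening δ (Metric.sphere c |ρ|) := fun x hx θ =>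
    Metric.mem_cthickening_of_dist_le _ _ _ _ (circleMap_mem_sphere' c ρ θ) (by
      simpa [circleMap, dist_eq_norm, ← sub_mul, ← Complex.ofReal_sub, Real.dist_eq]
        using (Metric.mem_ball.1 hx).le)
  obtain ⟨B, hB⟩ := (isCompact_sphere c |ρ|).cthickening.exists_bound_of_continuousOn
    (hg'.mono hδU)
  have hcont : ∀ x ∈ Metric.ball ρ δ, Continuous fun θ => g (circleMap c x θ) := fun x hx =>
    hg.continuousOn.comp_continuous (continuous_circleMap c x) fun θ => hδU (hmem x hx θ)
  have hcont' : Continuous fun θ => fderiv ℝ g (circleMap c ρ θ) (circleMap 0 1 θ) :=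
    (hg'.comp_continuous (continuous_circleMap c ρ) fun θ => hρU (circleMap_mem_sphere' c ρ θ))
      |>.clm_apply (continuous_circleMap 0 1)
  have hbound : ∀ θ, ∀ x ∈ Metric.ball ρ δ, ‖fderiv ℝ g (circleMap c x θ) (circleMap 0 1 θ)‖ ≤ B :=
    fun θ x hx => ((fderiv ℝ g _).le_opNorm _).trans (by simpa using hB _ (hmem x hx θ))
  have hderiv := intervalIntegral.hasDerivAt_integral_of_dominated_loc_of_deriv_le
    (F := fun x θ => g (circleMap c x θ)) (a := 0) (b := 2 * Real.pi) (μ := volume)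
    (Metric.ball_mem_nhds ρ hδ)
    (by filter_upwards [Metric.ball_mem_nhds ρ hδ] with x hx
        exact (hcont x hx).aestronglyMeasurable)
    ((hcont ρ (Metric.mem_ball_self hδ)).intervalIntegrable _ _) hcont'.aestronglyMeasurable
    (.of_forall fun θ _ => hbound θ) intervalIntegrable_const
    (.of_forall fun θ _ x hx => ((hg.differentiableOn one_ne_zero).differentiableAt
      (hU.mem_nhds (hδU (hmem x hx θ)))).hasFDerivAt.comp_hasDerivAt x
      (hasDerivAt_circleMap_radius c x θ))
  convert! hderiv.2.const_smul (2 * Real.pi)⁻¹ using 1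
  rw [Real.circleAverage_def, smul_comm, ← intervalIntegral.integral_smul]
  refine congrArg _ (intervalIntegral.integral_congr fun θ _ => ?_)
  have hsub : circleMap c ρ θ - c = ρ • circleMap 0 1 θ := by simp [circleMap]
  simp only [hsub, map_smul, inv_smul_smul₀ hρ]

lemma circleAverage_fderiv_I_mul_sub [CompleteSpace E] (hU : IsOpen U) (hg : ContDiffOn ℝ 1 g U)
    (hρU : Metric.sphere c |ρ| ⊆ U) :
    circleAverage (fun z => fderiv ℝ g z (Complex.I * (z - c))) c ρ = 0 := by
  have hg' := hg.continuousOn_fderiv_of_isOpen hU le_rfl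
  have hmem (θ : ℝ) : circleMap c ρ θ ∈ U := hρU (circleMap_mem_sphere' c ρ θ)
  have hderiv (θ : ℝ) : HasDerivAt (fun θ => g (circleMap c ρ θ))
      (fderiv ℝ g (circleMap c ρ θ) (Complex.I * (circleMap c ρ θ - c))) θ := by
    rw [circleMap_sub_center, mul_comm]
    exact ((hg.differentiableOn one_ne_zero).differentiableAt
      (hU.mem_nhds (hmem θ))).hasFDerivAt.comp_hasDerivAt θ (hasDerivAt_circleMap c ρ θ)
  have hcont : Continuous fun θ =>
      fderiv ℝ g (circleMap c ρ θ) (Complex.I * (circleMap c ρ θ - c)) :=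
    (hg'.comp_continuous (continuous_circleMap c ρ) hmem).clm_apply
      (continuous_const.mul ((continuous_circleMap c ρ).sub continuous_const))
  rw [Real.circleAverage_def, intervalIntegral.integral_eq_sub_of_hasDerivAt
    (fun θ _ => hderiv θ) (hcont.intervalIntegrable _ _), (periodic_circleMap c ρ).eq, sub_self,
    smul_zero]

end

/-- The `n`-th Laurent coefficient of `v` on the circle of radius `ρ` about the origin: if
`v z = ∑ n, a n * z ^ n` on that circle, then it equals `a n`. It depends on `ρ` unless `v` is
holomorphic. -/
def laurentCoeff (v : ℂ → ℂ) (n : ℤ) (ρ : ℝ) : ℂ := circleAverage (fun z => z ^ (-n) * v z) 0 ρ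

variable {U : Set ℂ} {v w : ℂ → ℂ} {n : ℤ} {ρ : ℝ}

lemma ne_zero_of_mem_sphere_abs {z : ℂ} (hρ : ρ ≠ 0) (hz : z ∈ Metric.sphere 0 |ρ|) : z ≠ 0 :=
  ne_zero_of_mem_sphere (abs_ne_zero.2 hρ) ⟨z, hz⟩

lemma circleIntegrable_zpow_mul (hρ : ρ ≠ 0) (hv : ContinuousOn v (Metric.sphere 0 |ρ|)) (n : ℤ) :
    CircleIntegrable (fun z => z ^ n * v z) 0 ρ :=
  ContinuousOn.circleIntegrable' ((continuousOn_id.zpow₀ n fun _ hz =>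
    Or.inl (ne_zero_of_mem_sphere_abs hρ hz)).mul hv)

lemma laurentCoeff_congr (h : EqOn v w (Metric.sphere 0 |ρ|)) (n : ℤ) :
    laurentCoeff v n ρ = laurentCoeff w n ρ :=
  Real.circleAverage_congr_sphere fun z hz => by simp only [h hz]

lemma laurentCoeff_add (hρ : ρ ≠ 0) (hv : ContinuousOn v (Metric.sphere 0 |ρ|))
    (hw : ContinuousOn w (Metric.sphere 0 |ρ|)) (n : ℤ) :
    laurentCoeff (fun z => v z + w z) n ρ = laurentCoeff v n ρ + laurentCoeff w n ρ := by
  simp only [laurentCoeff, mul_add]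
  exact Real.circleAverage_fun_add (circleIntegrable_zpow_mul hρ hv _)
    (circleIntegrable_zpow_mul hρ hw _)

lemma laurentCoeff_const_mul (c : ℂ) (v : ℂ → ℂ) (n : ℤ) (ρ : ℝ) :
    laurentCoeff (fun z => c * v z) n ρ = c * laurentCoeff v n ρ := by
  simp only [laurentCoeff, mul_left_comm _ c]
  exact Real.circleAverage_fun_smul (a := c)

lemma laurentCoeff_id_mul (hρ : ρ ≠ 0) (v : ℂ → ℂ) (n : ℤ) :
    laurentCoeff (fun z => z * v z) n ρ = laurentCoeff v (n - 1) ρ :=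
  Real.circleAverage_congr_sphere fun z hz => by
    rw [show -(n - 1) = -n + 1 by ring, zpow_add_one₀ (ne_zero_of_mem_sphere_abs hρ hz), mul_assoc]

lemma laurentCoeff_conj_mul (hρ : ρ ≠ 0) (v : ℂ → ℂ) (n : ℤ) :
    laurentCoeff (fun z => conj z * v z) n ρ = ρ ^ 2 * laurentCoeff v (n + 1) ρ := by
  rw [← laurentCoeff_const_mul]
  refine Real.circleAverage_congr_sphere fun z hz => ?_
  have hz0 := ne_zero_of_mem_sphere_abs hρ hz
  have hconj : conj z * z = ρ ^ 2 := by
    rw [← Complex.normSq_eq_conj_mul_self, Complex.normSq_eq_norm_sq, mem_sphere_zero_iff_norm.1 hz,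
      sq_abs, Complex.ofReal_pow]
  simp only [neg_add, zpow_add₀ hz0, zpow_neg_one]
  field_simp
  linear_combination v z * hconj

lemma norm_laurentCoeff_le {B : ℝ} (hv : ∀ z ∈ Metric.sphere 0 |ρ|, ‖v z‖ ≤ B) (n : ℤ) :
    ‖laurentCoeff v n ρ‖ ≤ |ρ| ^ (-n) * B := by
  have hbound : ∀ θ ∈ uIoc 0 (2 * Real.pi),
      ‖circleMap 0 ρ θ ^ (-n) * v (circleMap 0 ρ θ)‖ ≤ |ρ| ^ (-n) * B := fun θ _ => by
    rw [norm_mul, norm_zpow, norm_circleMap_zero]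
    exact mul_le_mul_of_nonneg_left (hv _ (circleMap_mem_sphere' 0 ρ θ)) (by positivity)
  rw [laurentCoeff, Real.circleAverage_def, norm_smul, norm_inv, Real.norm_eq_abs,
    inv_mul_le_iff₀ (by positivity), mul_comm |2 * Real.pi|]
  simpa only [sub_zero] using intervalIntegral.norm_integral_le_of_norm_le_const hbound

lemma fderiv_zpow_mul_apply {z : ℂ} (hz : z ≠ 0) (hv : DifferentiableAt ℝ v z) (n : ℤ) (w : ℂ) :
    fderiv ℝ (fun z => z ^ n * v z) z w =
      n * z ^ (n - 1) * w * v z + z ^ n * (dz v z * w + dzbar v z * conj w) := by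
  have hpow := (hasDerivAt_zpow n z (Or.inl hz)).hasFDerivAt.restrictScalars ℝ
  rw [(hpow.fun_mul hv.hasFDerivAt).fderiv]
  simp only [fderiv_apply_eq_dz_dzbar, add_apply, smul_apply,
    ContinuousLinearMap.coe_restrictScalars', ContinuousLinearMap.toSpanSingleton_apply,
    smul_eq_mul]
  ring

lemma contDiffOn_zpow_mul (hv : ContDiffOn ℝ 1 v U) (n : ℤ) :
    ContDiffOn ℝ 1 (fun z => z ^ n * v z) (U \ {0}) := by
  have hpow (z : ℂ) (hz : z ≠ 0) : ContDiffAt ℝ 1 (fun z : ℂ => z ^ n) z :=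
    ((analyticAt_id (𝕜 := ℂ)).zpow hz).contDiffAt.restrict_scalars ℝ
  exact ContDiffOn.mul (fun z hz => (hpow z hz.2).contDiffWithinAt) (hv.mono sdiff_subset)

section Derivative

variable (hU : IsOpen U) (hv : ContDiffOn ℝ 1 v U) (hρU : Metric.sphere 0 |ρ| ⊆ U) (hρ : ρ ≠ 0)
  (n : ℤ)
include hU hv hρU hρ

lemma circleAverage_fderiv_zpow_mul (c : ℂ) :
    circleAverage (fun z => fderiv ℝ (fun z => z ^ (-n) * v z) z (c * (z - 0))) 0 ρ =
      c * (laurentCoeff (dz v) (n - 1) ρ - n * laurentCoeff v n ρ) +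
        conj c * (ρ ^ 2 * laurentCoeff (dzbar v) (n + 1) ρ) := by
  have hv' : ContDiffOn ℝ (0 + 1) v U := by simpa using hv
  have hcont := hv.continuousOn.mono hρU
  have hdz := (contDiffOn_dz hU hv').continuousOn.mono hρU
  have hdzbar := (contDiffOn_dzbar hU hv').continuousOn.mono hρU
  have hcont_dz : ContinuousOn (fun z => c * (z * dz v z)) (Metric.sphere 0 |ρ|) := by fun_prop
  have hcont_v : ContinuousOn (fun z => -n * c * v z) (Metric.sphere 0 |ρ|) := by fun_prop
  have hcont_dzbar : ContinuousOn (fun z => conj c * (conj z * dzbar v z)) (Metric.sphere 0 |ρ|) :=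
    continuousOn_const.mul (Complex.continuous_conj.continuousOn.mul hdzbar)
  have hsum : laurentCoeff (fun z => c * (z * dz v z) + -n * c * v z +
      conj c * (conj z * dzbar v z)) n ρ = c * (laurentCoeff (dz v) (n - 1) ρ -
        n * laurentCoeff v n ρ) + conj c * (ρ ^ 2 * laurentCoeff (dzbar v) (n + 1) ρ) := by
    rw [laurentCoeff_add hρ (hcont_dz.fun_add hcont_v) hcont_dzbar,
      laurentCoeff_add hρ hcont_dz hcont_v,
      laurentCoeff_const_mul, laurentCoeff_const_mul, laurentCoeff_const_mul,
      laurentCoeff_id_mul hρ, laurentCoeff_conj_mul hρ]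
    ring
  rw [← hsum]
  refine Real.circleAverage_congr_sphere fun z hz => ?_
  have hz0 := ne_zero_of_mem_sphere_abs hρ hz
  have hdiff := (hv.differentiableOn one_ne_zero).differentiableAt (hU.mem_nhds (hρU hz))
  simp only [sub_zero, fderiv_zpow_mul_apply hz0 hdiff, zpow_sub_one₀ hz0, map_mul, Int.cast_neg]
  field_simp
  ring

lemma laurentCoeff_dz :
    laurentCoeff (dz v) (n - 1) ρ =
      n * laurentCoeff v n ρ + ρ ^ 2 * laurentCoeff (dzbar v) (n + 1) ρ := by
  have hangular := circleAverage_fderiv_I_mul_sub (hU.sdiff isClosed_singleton)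
    (contDiffOn_zpow_mul hv (-n)) fun z hz => ⟨hρU hz, ne_zero_of_mem_sphere_abs hρ hz⟩
  rw [circleAverage_fderiv_zpow_mul hU hv hρU hρ, Complex.conj_I] at hangular
  apply mul_left_cancel₀ Complex.I_ne_zero
  linear_combination hangular

lemma hasDerivAt_laurentCoeff :
    HasDerivAt (laurentCoeff v n) (2 * ρ * laurentCoeff (dzbar v) (n + 1) ρ) ρ := by
  have hradial := hasDerivAt_circleAverage (hU.sdiff isClosed_singleton)
    (contDiffOn_zpow_mul hv (-n)) (fun z hz => ⟨hρU hz, ne_zero_of_mem_sphere_abs hρ hz⟩) hρ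
  have haverage := circleAverage_fderiv_zpow_mul hU hv hρU hρ n 1
  simp only [one_mul, map_one] at haverage
  convert! hradial using 1
  have hρ' : (ρ : ℂ) ≠ 0 := Complex.ofReal_ne_zero.2 hρ
  rw [haverage, laurentCoeff_dz hU hv hρU hρ, Complex.real_smul, Complex.ofReal_inv]
  field_simp
  ring

end Derivative

lemma hasSum_laurentCoeff_mul_zpow (hρ : ρ ≠ 0) (hv : ContinuousOn v (Metric.sphere 0 |ρ|))
    (hs : Summable fun n : ℤ => laurentCoeff v n ρ * ρ ^ n) {z : ℂ}
    (hz : z ∈ Metric.sphere 0 |ρ|) : HasSum (fun n : ℤ => laurentCoeff v n ρ * z ^ n) (v z) := by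
  have : Fact (0 < 2 * Real.pi) := ⟨Real.two_pi_pos⟩
  have hcircle (θ : ℝ) : ρ * (AddCircle.toCircle (θ : AddCircle (2 * Real.pi)) : ℂ) =
      circleMap 0 ρ θ := by
    rw [AddCircle.toCircle_apply_mk, Circle.coe_exp, div_self Real.two_pi_pos.ne', one_mul,
      circleMap_zero]
  have hcont : Continuous fun x : AddCircle (2 * Real.pi) => v (ρ * (AddCircle.toCircle x : ℂ)) :=
    hv.comp_continuous (continuous_const.mul (continuous_subtype_val.comp
      AddCircle.continuous_toCircle)) fun x => by simp [Circle.norm_coe]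
  have hfourier (n : ℤ) (x : AddCircle (2 * Real.pi)) :
      ρ ^ n * fourier n x = (ρ * (AddCircle.toCircle x : ℂ)) ^ n := by
    rw [fourier_apply, AddCircle.toCircle_zsmul, Circle.coe_zpow, mul_zpow]
  have hρn (n : ℤ) : (ρ : ℂ) ^ n ≠ 0 := zpow_ne_zero _ (Complex.ofReal_ne_zero.2 hρ)
  have hcoeff (n : ℤ) : fourierCoeff (fun x : AddCircle (2 * Real.pi) =>
      v (ρ * (AddCircle.toCircle x : ℂ))) n = laurentCoeff v n ρ * ρ ^ n := by
    rw [fourierCoeff_eq_intervalIntegral _ n 0, zero_add, one_div, laurentCoeff,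
      Real.circleAverage_def, smul_mul_assoc, ← intervalIntegral.integral_mul_const]
    refine congrArg _ (intervalIntegral.integral_congr fun θ _ => ?_)
    simp only [← hcircle, ← hfourier, smul_eq_mul, zpow_neg]
    field_simp [hρn n]
  obtain ⟨θ, rfl⟩ : z ∈ range (circleMap 0 ρ) := by rwa [range_circleMap]
  have hsum := has_pointwise_sum_fourier_series_of_summable
    (f := (⟨_, hcont⟩ : C(AddCircle (2 * Real.pi), ℂ))) (hs.congr fun n => (hcoeff n).symm)
    (θ : AddCircle (2 * Real.pi))
  simpa only [ContinuousMap.coe_mk, hcoeff, smul_eq_mul, mul_assoc, hfourier, hcircle] using hsum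

end CircleAverage

section WeightSolution

/-! ### The solutions of weight `n` -/

lemma poch_succ (x y : ℂ) (k : ℕ) : poch x y (k + 1) = poch x y k * (x + k * y) :=
  Finset.prod_range_succ _ _

lemma norm_poch_div_poch_le {α β : ℂ} {γ C : ℝ} (hγ : 0 ≤ γ) (hα : ‖α‖ ≤ C * γ) (hβ : ‖β‖ ≤ C)
    (k : ℕ) : ‖poch α β k / poch γ 1 k‖ ≤ C ^ k := by
  have hC : 0 ≤ C := (norm_nonneg β).trans hβ
  rw [poch, poch, ← Finset.prod_div_distrib, norm_prod]
  refine (Finset.prod_le_prod (g := fun _ => C) (fun _ _ => norm_nonneg _) fun i _ => ?_).trans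
    (by simp)
  rw [norm_div]
  refine div_le_of_le_mul₀ (norm_nonneg _) hC ?_
  have hden : ‖(γ : ℂ) + i * 1‖ = γ + i := by
    rw [mul_one, ← Complex.ofReal_natCast, ← Complex.ofReal_add, Complex.norm_real,
      Real.norm_of_nonneg (by positivity)]
  calc ‖α + i * β‖ ≤ ‖α‖ + i * ‖β‖ := (norm_add_le _ _).trans_eq (by simp)
    _ ≤ C * γ + i * C := by gcongr
    _ = C * ‖(γ : ℂ) + i * 1‖ := by rw [hden]; ring

lemma tendsto_P_add_mul_atTop (a b β x : ℂ) :
    Tendsto (fun m : ℕ => P (a + b * m) β (m + 1) x) atTop (𝓝 (Complex.exp (b * x))) := by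
  set C := ‖a‖ + ‖b‖ + ‖β‖
  have hnum (m : ℕ) : ‖a + b * m‖ ≤ C * (m + 1 : ℝ) := by
    calc ‖a + b * m‖ ≤ ‖a‖ + ‖b‖ * m := (norm_add_le _ _).trans_eq (by simp)
      _ ≤ C * (m + 1) := by
        nlinarith [norm_nonneg a, norm_nonneg b, norm_nonneg β, m.cast_nonneg (α := ℝ),
          mul_nonneg (norm_nonneg a) m.cast_nonneg, mul_nonneg (norm_nonneg β) m.cast_nonneg]
  have hterm (k : ℕ) : Tendsto (fun m : ℕ => poch (a + b * m) β k / poch (m + 1) 1 k) atTop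
      (𝓝 (b ^ k)) := by
    simp only [poch, ← Finset.prod_div_distrib]
    rw [← Finset.card_range k, ← Finset.prod_const, Finset.card_range]
    refine tendsto_finsetProd _ fun i _ => ?_
    have hinv : Tendsto (fun m : ℕ => ((m : ℂ) + 1 + i)⁻¹) atTop (𝓝 0) := by
      refine ((tendsto_inv_atTop_nhds_zero_nat (𝕜 := ℂ)).comp
        (tendsto_add_atTop_nat (1 + i))).congr fun m => ?_
      simp [add_assoc]
    have hlim := (hinv.const_mul (a + i * β - b * (1 + i))).const_add b
    rw [mul_zero, add_zero] at hlim
    refine hlim.congr fun m => ?_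
    have hne : (m : ℂ) + 1 + i ≠ 0 := mod_cast (m + 1 + i).cast_ne_zero.2 (by lia)
    rw [mul_one, eq_div_iff hne, add_mul, inv_mul_cancel_right₀ hne]
    ring
  have hexp : Complex.exp (b * x) = ∑' k : ℕ, b ^ k * (x ^ k / (k ! : ℂ)) := by
    rw [Complex.exp_eq_exp_ℂ, NormedSpace.exp_eq_tsum_div]
    exact tsum_congr fun k => by rw [mul_pow, mul_div_assoc]
  rw [hexp]
  refine tendsto_tsum_of_dominated_convergence (bound := fun k => (C * ‖x‖) ^ k / k !)
    (Real.summable_pow_div_factorial _) (fun k => (hterm k).mul_const _)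
    (Eventually.of_forall fun m k => ?_)
  have hle := norm_poch_div_poch_le (γ := m + 1) (by positivity) (hnum m)
    (le_add_of_nonneg_left (by positivity) : ‖β‖ ≤ C) k
  push_cast at hle
  rw [norm_mul, mul_pow, mul_div_assoc]
  gcongr
  simp

/-- The coefficient of `|z| ^ (2 * k)` in the radial factor of the solution of weight `n`. With
`n.toNat` and `(-n).toNat` for the positive and negative parts of `n`, this covers the positive
and the negative weights of the expansion at once. -/
def weightCoeff (s t r : ℂ) (n : ℤ) (k : ℕ) : ℂ :=
  poch (r + s * n.toNat + t * (-n).toNat) (s + t) k / poch (n.natAbs + 1) 1 k / (k ! : ℂ)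

/-- The solution `𝒫(r + s n⁺ + t n⁻, s + t | |n| + 1; |z|²) * z ^ n⁺ * conj z ^ n⁻` of weight `n`,
where `n⁺` and `n⁻` are the positive and negative parts of the integer `n`. -/
def weightSolution (s t r : ℂ) (n : ℤ) (z : ℂ) : ℂ :=
  P (r + s * n.toNat + t * (-n).toNat) (s + t) (n.natAbs + 1) ((‖z‖ ^ 2 : ℝ) : ℂ) *
    z ^ n.toNat * conj z ^ (-n).toNat

variable {s t r : ℂ} {n : ℤ}

lemma natCast_natAbs_eq_toNat_add_toNat (n : ℤ) : (n.natAbs : ℂ) = n.toNat + (-n).toNat := by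
  have : n.natAbs = n.toNat + (-n).toNat := by lia
  exact_mod_cast this

lemma toNat_mul_toNat_neg (n : ℤ) : n.toNat * (-n).toNat = 0 := by
  rcases le_total 0 n with h | h <;> simp [h]

lemma natCast_toNat_mul_toNat_neg (n : ℤ) : (n.toNat * (-n).toNat : ℂ) = 0 :=
  mod_cast toNat_mul_toNat_neg n

lemma weightCoeff_succ (s t r : ℂ) (n : ℤ) (k : ℕ) :
    ((n.toNat + k + 1) * ((-n).toNat + k + 1)) * weightCoeff s t r n (k + 1) =
      (s * (n.toNat + k) + t * ((-n).toNat + k) + r) * weightCoeff s t r n k := by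
  have hmul := natCast_toNat_mul_toNat_neg n
  have hγ : (n.toNat + (-n).toNat + 1 + k : ℂ) ≠ 0 :=
    mod_cast (n.toNat + (-n).toNat + 1 + k).cast_ne_zero.2 (by lia)
  have hk : (k + 1 : ℂ) ≠ 0 := k.cast_add_one_ne_zero
  have hden : ((n.toNat + k + 1) * ((-n).toNat + k + 1) : ℂ) =
      (n.toNat + (-n).toNat + 1 + k) * (k + 1) := by linear_combination hmul
  rw [weightCoeff, weightCoeff, natCast_natAbs_eq_toNat_add_toNat, poch_succ, poch_succ, hden,
    Nat.factorial_succ]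
  push_cast
  field_simp
  ring

lemma norm_weightCoeff_le (s t r : ℂ) (n : ℤ) (k : ℕ) :
    ‖weightCoeff s t r n k‖ ≤ (‖r‖ + ‖s‖ + ‖t‖) ^ k / k ! := by
  have hα : ‖r + s * n.toNat + t * (-n).toNat‖ ≤ (‖r‖ + ‖s‖ + ‖t‖) * (n.natAbs + 1 : ℝ) := by
    have h1 : (n.toNat : ℝ) ≤ n.natAbs + 1 := mod_cast (by lia)
    have h2 : ((-n).toNat : ℝ) ≤ n.natAbs + 1 := mod_cast (by lia)
    calc ‖r + s * n.toNat + t * (-n).toNat‖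
        ≤ ‖r‖ * 1 + ‖s‖ * n.toNat + ‖t‖ * (-n).toNat := norm_add₃_le.trans_eq (by simp)
      _ ≤ ‖r‖ * (n.natAbs + 1) + ‖s‖ * (n.natAbs + 1) + ‖t‖ * (n.natAbs + 1) := by
        gcongr
        simp
      _ = _ := by ring
  have hβ : ‖s + t‖ ≤ ‖r‖ + ‖s‖ + ‖t‖ := by
    linarith [norm_add_le s t, norm_nonneg r]
  have hle := norm_poch_div_poch_le (by positivity) hα hβ k
  rw [weightCoeff, norm_div, Complex.norm_natCast]
  gcongr
  exact_mod_cast hle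

lemma absConv_mul_weightCoeff {R : ℝ} {c : ℤ → ℂ}
    (hc : ∀ ρ, 0 < ρ → ρ < R → Summable fun n : ℤ => ‖c n‖ * ρ ^ n.natAbs) :
    AbsConv R (fun i : ℤ × ℕ => c i.1 * weightCoeff s t r i.1 i.2) (fun i => i.1.toNat + i.2)
      fun i => (-i.1).toNat + i.2 := by
  intro ρ h0 h1
  refine .of_nonneg_of_le (fun _ => by positivity) (fun i => ?_)
    ((hc ρ h0 h1).mul_of_nonneg (Real.summable_pow_div_factorial ((‖r‖ + ‖s‖ + ‖t‖) * ρ ^ 2))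
      (fun _ => by positivity) fun _ => by positivity)
  have hexp : i.1.toNat + i.2 + ((-i.1).toNat + i.2) = i.1.natAbs + 2 * i.2 := by lia
  calc ‖c i.1 * weightCoeff s t r i.1 i.2‖ * ρ ^ (i.1.toNat + i.2 + ((-i.1).toNat + i.2))
      ≤ ‖c i.1‖ * ((‖r‖ + ‖s‖ + ‖t‖) ^ i.2 / i.2 !) * ρ ^ (i.1.natAbs + 2 * i.2) := by
        rw [norm_mul, hexp]
        gcongr
        exact norm_weightCoeff_le s t r i.1 i.2
    _ = ‖c i.1‖ * ρ ^ i.1.natAbs * (((‖r‖ + ‖s‖ + ‖t‖) * ρ ^ 2) ^ i.2 / i.2 !) := by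
        rw [mul_pow]; ring

lemma absConv_weightCoeff (s t r : ℂ) (n : ℤ) (R : ℝ) :
    AbsConv R (weightCoeff s t r n) (fun k => n.toNat + k) fun k => (-n).toNat + k := by
  intro ρ h0 h1
  have h := absConv_mul_weightCoeff (s := s) (t := t) (r := r) (R := R) (c := Pi.single n 1)
    (fun ρ _ _ => summable_of_ne_finset_zero (s := {n}) fun b hb => by simp_all) ρ h0 h1
  simpa using h.prod_factor n

lemma weightSolution_eq_biseries (s t r : ℂ) (n : ℤ) :
    weightSolution s t r n =
      biseries (weightCoeff s t r n) (fun k => n.toNat + k) fun k => (-n).toNat + k := by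
  ext z
  have hz : ((‖z‖ ^ 2 : ℝ) : ℂ) = z * conj z := by rw [Complex.mul_conj', Complex.ofReal_pow]
  rw [weightSolution, P, biseries, hz, mul_assoc, ← tsum_mul_right]
  refine tsum_congr fun k => ?_
  rw [weightCoeff]
  ring

lemma isSolution_weightSolution (s t r : ℂ) (n : ℤ) :
    IsSolution s t r (weightSolution s t r n) := by
  have h := absConv_weightCoeff s t r n 1
  rw [weightSolution_eq_biseries]
  refine ⟨mod_cast h.contDiffOn_natCast 2, fun z hz => ?_⟩
  set w := biseries (weightCoeff s t r n) (fun k => n.toNat + k) fun k => (-n).toNat + k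
  have hmixed : HasSum (fun k => ((n.toNat + k + 1) * ((-n).toNat + k + 1)) *
      weightCoeff s t r n (k + 1) * z ^ (n.toNat + k) * conj z ^ ((-n).toNat + k))
      (dz (dzbar w) z) := by
    have hsum := h.hasSum_dz_dzbar hz
    rw [← hasSum_nat_add_iff' 1, Finset.sum_range_one, add_zero, add_zero, ← mul_assoc,
      natCast_toNat_mul_toNat_neg, zero_mul, zero_mul, zero_mul, sub_zero] at hsum
    refine hsum.congr_fun fun k => ?_
    simp only [← add_assoc, Nat.add_sub_cancel]
    push_cast
    ring
  have hlower :=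
    (((h.hasSum_mul_dz hz).mul_left s).add ((h.hasSum_conj_mul_dzbar hz).mul_left t)).add
      ((h.summable hz).hasSum.mul_left r)
  have heq := hmixed.unique (hlower.congr_fun fun k => ?_)
  · rw [M, heq]
    change _ - _ - _ - r * ∑' k, _ = 0
    ring
  · rw [weightCoeff_succ]
    push_cast
    ring

lemma laurentCoeff_weightSolution {ρ : ℝ} (hρ : ρ ≠ 0) :
    laurentCoeff (weightSolution s t r n) n ρ =
      P (r + s * n.toNat + t * (-n).toNat) (s + t) (n.natAbs + 1) (ρ ^ 2) *
        ρ ^ (2 * (-n).toNat) := by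
  refine Real.circleAverage_const_on_circle fun z hz => ?_
  have hz0 : z ≠ 0 := ne_zero_of_mem_sphere_abs hρ hz
  have hnorm : (‖z‖ : ℂ) ^ 2 = ρ ^ 2 := by
    rw [mem_sphere_zero_iff_norm.1 hz]
    exact_mod_cast sq_abs ρ
  have hpow : z ^ (-n) * z ^ n.toNat = z ^ (-n).toNat := by
    rw [← zpow_natCast, ← zpow_natCast, ← zpow_add₀ hz0]
    congr 1
    lia
  calc z ^ (-n) * weightSolution s t r n z
      = P (r + s * n.toNat + t * (-n).toNat) (s + t) (n.natAbs + 1) (‖z‖ ^ 2) *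
          ((z ^ (-n) * z ^ n.toNat) * conj z ^ (-n).toNat) := by
        rw [weightSolution, Complex.ofReal_pow]; ring
    _ = _ := by rw [hpow, ← mul_pow, Complex.mul_conj', hnorm, pow_mul]

lemma laurentCoeff_weightSolution_mul_zpow {z : ℂ} (hz : z ≠ 0) :
    laurentCoeff (weightSolution s t r n) n ‖z‖ * z ^ n = weightSolution s t r n z := by
  have hpow : z ^ (-n).toNat * z ^ n = z ^ n.toNat := by
    rw [← zpow_natCast, ← zpow_natCast, ← zpow_add₀ hz]
    congr 1
    lia
  rw [laurentCoeff_weightSolution (norm_ne_zero_iff.2 hz), weightSolution, pow_mul,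
    ← Complex.mul_conj', mul_pow, ← hpow, Complex.mul_conj', Complex.ofReal_pow]
  ring

lemma exists_laurentCoeff_weightSolution_ne_zero (s t r : ℂ) (n : ℤ) :
    ∃ ρ ∈ Ioo (0 : ℝ) 1, laurentCoeff (weightSolution s t r n) n ρ ≠ 0 := by
  set a := r + s * n.toNat + t * (-n).toNat
  have hP : Tendsto (fun ρ : ℝ => P a (s + t) (n.natAbs + 1) (ρ ^ 2)) (𝓝[>] 0) (𝓝 1) := by
    have h : AbsConv 1 (weightCoeff s t r n) id fun _ => 0 := fun ρ h0 h1 => by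
      refine .of_nonneg_of_le (fun _ => by positivity) (fun k => ?_)
        (Real.summable_pow_div_factorial (‖r‖ + ‖s‖ + ‖t‖))
      exact (mul_le_of_le_one_right (norm_nonneg _) (pow_le_one₀ h0.le h1.le)).trans
        (norm_weightCoeff_le s t r n k)
    have hPz (z : ℂ) : P a (s + t) (n.natAbs + 1) z =
        biseries (weightCoeff s t r n) id (fun _ => 0) z := by
      rw [P, biseries]
      refine tsum_congr fun k => ?_
      rw [weightCoeff, id, pow_zero]
      ring
    have hcont : ContinuousAt (P a (s + t) (n.natAbs + 1)) 0 := by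
      rw [funext hPz]
      exact h.contDiffOn.continuousOn.continuousAt (Metric.ball_mem_nhds 0 one_pos)
    have hlim : Tendsto (fun ρ : ℝ => (ρ : ℂ) ^ 2) (𝓝[>] 0) (𝓝 0) :=
      tendsto_nhdsWithin_of_tendsto_nhds <| (by fun_prop :
        Continuous fun ρ : ℝ => (ρ : ℂ) ^ 2).tendsto' 0 0 (by simp)
    have h1 : P a (s + t) (n.natAbs + 1) 0 = 1 := by
      rw [P, tsum_eq_single 0 fun k hk => by simp [hk]]
      simp [poch]
    simpa only [Function.comp_def, h1] using hcont.tendsto.comp hlim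
  have hne := hP.eventually_ne one_ne_zero
  obtain ⟨ρ, hρ, hρ01⟩ := (hne.and (Ioo_mem_nhdsGT one_pos)).exists
  refine ⟨ρ, hρ01, ?_⟩
  have : (ρ : ℂ) ≠ 0 := mod_cast hρ01.1.ne'
  rw [laurentCoeff_weightSolution hρ01.1.ne']
  positivity

end WeightSolution

section RadialSystem

/-! ### The radial system -/

lemma eqOn_Ioo_of_hasDerivAt_clm_apply {E : Type*} [NormedAddCommGroup E] [NormedSpace ℝ E]
    {A : ℝ → E →L[ℝ] E} {X Y : ℝ → E} {a b t₀ : ℝ} (hA : ContinuousOn A (Ioo a b))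
    (hX : ∀ t ∈ Ioo a b, HasDerivAt X (A t (X t)) t)
    (hY : ∀ t ∈ Ioo a b, HasDerivAt Y (A t (Y t)) t) (ht₀ : t₀ ∈ Ioo a b) (h : X t₀ = Y t₀) :
    EqOn X Y (Ioo a b) := by
  intro t ht
  obtain ⟨a', ha, ha'⟩ := exists_between (lt_min ht.1 ht₀.1)
  obtain ⟨b', hb', hb⟩ := exists_between (max_lt ht.2 ht₀.2)
  rw [lt_min_iff] at ha'
  rw [max_lt_iff] at hb'
  have hsub : Ioo a' b' ⊆ Ioo a b := Ioo_subset_Ioo ha.le hb.le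
  obtain ⟨K, hK⟩ := isCompact_Icc.exists_bound_of_continuousOn
    (hA.mono fun x hx => ⟨ha.trans_le hx.1, hx.2.trans_lt hb⟩ : ContinuousOn A (Icc a' b'))
  have hlip (x) (hx : x ∈ Ioo a' b') : LipschitzOnWith K.toNNReal (A x) univ :=
    ((A x).lipschitz.weaken
      (NNReal.coe_le_coe.1
        ((hK x (Ioo_subset_Icc_self hx)).trans K.le_coe_toNNReal))).lipschitzOnWith
  exact ODE_solution_unique_of_mem_Ioo (v := fun x => A x) (s := fun _ => univ) hlip
    ⟨ha'.2, hb'.2⟩ (fun x hx => ⟨hX x (hsub hx), mem_univ _⟩)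
    (fun x hx => ⟨hY x (hsub hx), mem_univ _⟩) h ⟨ha'.1, hb'.1⟩

variable {s t r : ℂ} {u v : ℂ → ℂ} {ρ : ℝ}

lemma sphere_abs_subset_disc (hρ : ρ ∈ Ioo (0 : ℝ) 1) : Metric.sphere 0 |ρ| ⊆ disc :=
  Metric.sphere_subset_ball ((abs_of_pos hρ.1).trans_lt hρ.2)

namespace IsSolution

lemma contDiffOn_dzbar (hu : IsSolution s t r u) : ContDiffOn ℝ 1 (dzbar u) disc :=
  GenHarmonic.contDiffOn_dzbar Metric.isOpen_ball hu.contDiffOn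

lemma hasDerivAt_laurentCoeff (hu : IsSolution s t r u) (n : ℤ) (hρ : ρ ∈ Ioo (0 : ℝ) 1) :
    HasDerivAt (laurentCoeff u n) (2 * ρ * laurentCoeff (dzbar u) (n + 1) ρ) ρ :=
  GenHarmonic.hasDerivAt_laurentCoeff Metric.isOpen_ball (hu.contDiffOn.of_le one_le_two)
    (sphere_abs_subset_disc hρ) hρ.1.ne' n

lemma laurentCoeff_dz_dzbar (hu : IsSolution s t r u) (n : ℤ) (hρ : ρ ∈ Ioo (0 : ℝ) 1) :
    laurentCoeff (dz (dzbar u)) n ρ = (r + s * n) * laurentCoeff u n ρ +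
      (s + t) * ρ ^ 2 * laurentCoeff (dzbar u) (n + 1) ρ := by
  have hsub := sphere_abs_subset_disc hρ
  have hu1 : ContDiffOn ℝ 1 u disc := hu.contDiffOn.of_le one_le_two
  have hcont := hu1.continuousOn.mono hsub
  have hdzbar := hu.contDiffOn_dzbar.continuousOn.mono hsub
  have hdz := (contDiffOn_dz (U := disc) (n := 0) Metric.isOpen_ball
    (by simpa using hu1)).continuousOn.mono hsub
  have heq : EqOn (dz (dzbar u))
      (fun z => s * (z * dz u z) + t * (conj z * dzbar u z) + r * u z) (Metric.sphere 0 |ρ|) :=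
    fun z hz => by
      have h := hu.eq_zero z (hsub hz)
      rw [M] at h
      linear_combination h
  rw [laurentCoeff_congr heq, laurentCoeff_add hρ.1.ne' (by fun_prop) (by fun_prop),
    laurentCoeff_add hρ.1.ne' (by fun_prop) (by fun_prop), laurentCoeff_const_mul,
    laurentCoeff_const_mul, laurentCoeff_const_mul, laurentCoeff_id_mul hρ.1.ne',
    laurentCoeff_conj_mul hρ.1.ne', laurentCoeff_dz Metric.isOpen_ball hu1 hsub hρ.1.ne']
  ring

lemma hasDerivAt_laurentCoeff_dzbar (hu : IsSolution s t r u) (n : ℤ)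
    (hρ : ρ ∈ Ioo (0 : ℝ) 1) :
    HasDerivAt (laurentCoeff (dzbar u) (n + 1))
      (2 / ρ * ((r + s * n) * laurentCoeff u n ρ +
        ((s + t) * ρ ^ 2 - (n + 1)) * laurentCoeff (dzbar u) (n + 1) ρ)) ρ := by
  have hsub := sphere_abs_subset_disc hρ
  have hdz := laurentCoeff_dz Metric.isOpen_ball hu.contDiffOn_dzbar hsub hρ.1.ne' (n + 1)
  rw [add_sub_cancel_right, hu.laurentCoeff_dz_dzbar n hρ] at hdz
  convert! GenHarmonic.hasDerivAt_laurentCoeff Metric.isOpen_ball hu.contDiffOn_dzbar hsub hρ.1.ne'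
    (n + 1) using 1
  have : (ρ : ℂ) ≠ 0 := mod_cast hρ.1.ne'
  field_simp
  push_cast at hdz
  linear_combination hdz

end IsSolution

/-- The matrix of the first order system satisfied on `(0, 1)` by the Laurent coefficients of weight
`n` of a solution and of weight `n + 1` of its `∂̄`-derivative. -/
def radialCLM (s t r : ℂ) (n : ℤ) (ρ : ℝ) : ℂ × ℂ →L[ℝ] ℂ × ℂ :=
  (2 * ρ : ℂ) • (ContinuousLinearMap.inl ℝ ℂ ℂ ∘L ContinuousLinearMap.snd ℝ ℂ ℂ) +
    (2 / ρ : ℂ) •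
      ((r + s * n) • (ContinuousLinearMap.inr ℝ ℂ ℂ ∘L ContinuousLinearMap.fst ℝ ℂ ℂ) +
        ((s + t) * ρ ^ 2 - (n + 1) : ℂ) •
          (ContinuousLinearMap.inr ℝ ℂ ℂ ∘L ContinuousLinearMap.snd ℝ ℂ ℂ))

lemma radialCLM_apply (s t r : ℂ) (n : ℤ) (ρ : ℝ) (f g : ℂ) :
    radialCLM s t r n ρ (f, g) =
      (2 * ρ * g, 2 / ρ * ((r + s * n) * f + ((s + t) * ρ ^ 2 - (n + 1)) * g)) := by
  simp [radialCLM, mul_add]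

lemma continuousOn_radialCLM (s t r : ℂ) (n : ℤ) :
    ContinuousOn (radialCLM s t r n) (Ioo 0 1) := by
  have hinv : ContinuousOn (fun ρ : ℝ => (2 / ρ : ℂ)) (Ioo 0 1) :=
    continuousOn_const.div (by fun_prop) fun ρ hρ => mod_cast hρ.1.ne'
  unfold radialCLM
  fun_prop

/-- The Wronskian of the solutions of the system `radialCLM` that come from `u` and `v`. -/
def wronskian (u v : ℂ → ℂ) (n : ℤ) (ρ : ℝ) : ℂ :=
  laurentCoeff u n ρ * laurentCoeff (dzbar v) (n + 1) ρ -
    laurentCoeff (dzbar u) (n + 1) ρ * laurentCoeff v n ρ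

namespace IsSolution

lemma hasDerivAt_wronskian (hu : IsSolution s t r u) (hv : IsSolution s t r v) (n : ℤ)
    (hρ : ρ ∈ Ioo (0 : ℝ) 1) :
    HasDerivAt (wronskian u v n)
      (2 / ρ * ((s + t) * ρ ^ 2 - (n + 1)) * wronskian u v n ρ) ρ := by
  convert! ((hu.hasDerivAt_laurentCoeff n hρ).mul (hv.hasDerivAt_laurentCoeff_dzbar n hρ)).sub
    ((hu.hasDerivAt_laurentCoeff_dzbar n hρ).mul (hv.hasDerivAt_laurentCoeff n hρ)) using 1
  rw [wronskian]
  ring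

lemma hasDerivAt_weighted_wronskian (hu : IsSolution s t r u) (hv : IsSolution s t r v) (n : ℤ)
    (hρ : ρ ∈ Ioo (0 : ℝ) 1) :
    HasDerivAt (fun ρ : ℝ => (ρ : ℂ) ^ (2 * n + 2) * Complex.exp (-(s + t) * ρ ^ 2) *
      wronskian u v n ρ) 0 ρ := by
  have hρ0 : (ρ : ℂ) ≠ 0 := mod_cast hρ.1.ne'
  have hpow := (hasDerivAt_zpow (2 * n + 2) (ρ : ℂ) (.inl hρ0)).comp_ofReal
  have hexp : HasDerivAt (fun ρ : ℝ => Complex.exp (-(s + t) * ρ ^ 2))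
      (Complex.exp (-(s + t) * ρ ^ 2) * (-(s + t) * (2 * ρ))) ρ := by
    simpa using (((hasDerivAt_pow 2 (ρ : ℂ)).const_mul (-(s + t))).cexp).comp_ofReal
  convert! (hpow.mul hexp).mul (hu.hasDerivAt_wronskian hv n hρ) using 1
  rw [Pi.mul_apply, zpow_sub_one₀ hρ0]
  field_simp
  push_cast
  ring

lemma exists_norm_laurentCoeff_le (hu : IsSolution s t r u) (n : ℤ) :
    ∃ B, ∀ ρ ∈ Ioo (0 : ℝ) (1 / 2), ‖laurentCoeff u n ρ‖ ≤ ρ ^ (-n) * B ∧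
      ‖laurentCoeff (dzbar u) (n + 1) ρ‖ ≤ ρ ^ (-(n + 1)) * B := by
  have hsub : Metric.closedBall (0 : ℂ) (1 / 2) ⊆ disc :=
    Metric.closedBall_subset_ball (by norm_num)
  obtain ⟨B₁, hB₁⟩ := (isCompact_closedBall (0 : ℂ) (1 / 2)).exists_bound_of_continuousOn
    (hu.contDiffOn.continuousOn.mono hsub)
  obtain ⟨B₂, hB₂⟩ := (isCompact_closedBall (0 : ℂ) (1 / 2)).exists_bound_of_continuousOn
    (hu.contDiffOn_dzbar.continuousOn.mono hsub)
  refine ⟨max B₁ B₂, fun ρ hρ => ?_⟩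
  have hmem (z : ℂ) (hz : z ∈ Metric.sphere 0 |ρ|) : z ∈ Metric.closedBall (0 : ℂ) (1 / 2) :=
    Metric.sphere_subset_closedBall.trans
      (Metric.closedBall_subset_closedBall ((abs_of_pos hρ.1).trans_le hρ.2.le)) hz
  have h₁ := norm_laurentCoeff_le (fun z hz => (hB₁ z (hmem z hz)).trans (le_max_left B₁ B₂)) n
  have h₂ := norm_laurentCoeff_le (fun z hz => (hB₂ z (hmem z hz)).trans (le_max_right B₁ B₂))
    (n + 1)
  rw [abs_of_pos hρ.1] at h₁ h₂
  exact ⟨h₁, h₂⟩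

lemma exists_norm_weighted_wronskian_le (hu : IsSolution s t r u) (hv : IsSolution s t r v)
    (n : ℤ) :
    ∃ C, ∀ ρ ∈ Ioo (0 : ℝ) (1 / 2), ‖(ρ : ℂ) ^ (2 * n + 2) * Complex.exp (-(s + t) * ρ ^ 2) *
      wronskian u v n ρ‖ ≤ C * ρ := by
  obtain ⟨B, hB⟩ := hu.exists_norm_laurentCoeff_le n
  obtain ⟨B', hB'⟩ := hv.exists_norm_laurentCoeff_le n
  refine ⟨Real.exp ‖s + t‖ * (2 * (B * B')), fun ρ hρ => ?_⟩
  obtain ⟨hρ0, hρ2⟩ := hρ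
  have hexp : ‖Complex.exp (-(s + t) * ρ ^ 2)‖ ≤ Real.exp ‖s + t‖ := by
    refine (Complex.norm_exp_le_exp_norm _).trans (Real.exp_le_exp.2 ?_)
    rw [norm_mul, norm_neg, norm_pow, Complex.norm_real, Real.norm_of_nonneg hρ0.le]
    exact mul_le_of_le_one_right (norm_nonneg _) (pow_le_one₀ hρ0.le (by linarith))
  have hW : ‖wronskian u v n ρ‖ ≤ ρ ^ (-n) * ρ ^ (-(n + 1)) * (2 * (B * B')) := by
    obtain ⟨h₁, h₂⟩ := hB ρ ⟨hρ0, hρ2⟩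
    obtain ⟨h₁', h₂'⟩ := hB' ρ ⟨hρ0, hρ2⟩
    refine (norm_sub_le _ _).trans ?_
    rw [norm_mul, norm_mul]
    calc _ ≤ ρ ^ (-n) * B * (ρ ^ (-(n + 1)) * B') + ρ ^ (-(n + 1)) * B * (ρ ^ (-n) * B') := by
          gcongr
          · exact (norm_nonneg _).trans h₁
          · exact (norm_nonneg _).trans h₂
      _ = _ := by ring
  have hpow : ρ ^ (2 * n + 2) * (ρ ^ (-n) * ρ ^ (-(n + 1))) = ρ := by
    rw [← zpow_add₀ hρ0.ne', ← zpow_add₀ hρ0.ne']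
    ring_nf
    exact zpow_one ρ
  rw [norm_mul, norm_mul, norm_zpow, Complex.norm_real, Real.norm_of_nonneg hρ0.le]
  calc ρ ^ (2 * n + 2) * ‖Complex.exp (-(s + t) * ρ ^ 2)‖ * ‖wronskian u v n ρ‖
      ≤ ρ ^ (2 * n + 2) * Real.exp ‖s + t‖ *
        (ρ ^ (-n) * ρ ^ (-(n + 1)) * (2 * (B * B'))) := by gcongr
    _ = _ := by linear_combination (Real.exp ‖s + t‖ * (2 * (B * B'))) * hpow

lemma wronskian_eq_zero (hu : IsSolution s t r u) (hv : IsSolution s t r v) (n : ℤ)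
    (hρ : ρ ∈ Ioo (0 : ℝ) 1) : wronskian u v n ρ = 0 := by
  obtain ⟨a, ha⟩ := isOpen_Ioo.exists_is_const_of_deriv_eq_zero isPreconnected_Ioo
    (fun ρ hρ => (hu.hasDerivAt_weighted_wronskian hv n hρ).differentiableAt.differentiableWithinAt)
    (fun ρ hρ => (hu.hasDerivAt_weighted_wronskian hv n hρ).deriv)
  obtain ⟨C, hC⟩ := hu.exists_norm_weighted_wronskian_le hv n
  have ha0 : ‖a‖ ≤ 0 := by
    have hlim : Tendsto (fun ρ : ℝ => C * ρ) (𝓝[>] 0) (𝓝 0) :=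
      tendsto_nhdsWithin_of_tendsto_nhds ((continuous_const_mul C).tendsto' 0 0 (mul_zero C))
    refine ge_of_tendsto hlim ?_
    filter_upwards [Ioo_mem_nhdsGT (by norm_num : (0 : ℝ) < 1 / 2)] with ρ hρ
    rw [← ha ρ ⟨hρ.1, hρ.2.trans (by norm_num)⟩]
    exact hC ρ hρ
  have hρ0 : (ρ : ℂ) ≠ 0 := mod_cast hρ.1.ne'
  have h := ha ρ hρ
  rw [norm_le_zero_iff.1 ha0] at h
  exact (mul_eq_zero.1 h).resolve_left (mul_ne_zero (zpow_ne_zero _ hρ0) (Complex.exp_ne_zero _))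

lemma exists_laurentCoeff_eq_mul (hu : IsSolution s t r u) (hv : IsSolution s t r v) (n : ℤ)
    (hne : ∃ ρ ∈ Ioo (0 : ℝ) 1, laurentCoeff v n ρ ≠ 0) :
    ∃ c : ℂ, ∀ ρ ∈ Ioo (0 : ℝ) 1, laurentCoeff u n ρ = c * laurentCoeff v n ρ := by
  obtain ⟨δ, hδ, hvδ⟩ := hne
  set c := laurentCoeff u n δ / laurentCoeff v n δ
  have hX := eqOn_Ioo_of_hasDerivAt_clm_apply (continuousOn_radialCLM s t r n)
    (X := fun ρ => (laurentCoeff u n ρ, laurentCoeff (dzbar u) (n + 1) ρ))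
    (Y := fun ρ => (c * laurentCoeff v n ρ, c * laurentCoeff (dzbar v) (n + 1) ρ))
    (fun ρ hρ => by
      rw [radialCLM_apply]
      exact (hu.hasDerivAt_laurentCoeff n hρ).prodMk (hu.hasDerivAt_laurentCoeff_dzbar n hρ))
    (fun ρ hρ => by
      convert! ((hv.hasDerivAt_laurentCoeff n hρ).const_mul c).prodMk
        ((hv.hasDerivAt_laurentCoeff_dzbar n hρ).const_mul c) using 1
      rw [radialCLM_apply]
      ring_nf)
    hδ (Prod.ext (div_mul_cancel₀ _ hvδ).symm ?_)
  · exact ⟨c, fun ρ hρ => congrArg Prod.fst (hX hρ)⟩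
  · have hW := hu.wronskian_eq_zero hv n hδ
    rw [wronskian, sub_eq_zero] at hW
    simp only [c]
    field_simp
    exact hW.symm

end IsSolution

end RadialSystem

section Expansion

/-! ### The expansion -/

lemma summable_norm_mul_pow_of_tendsto {d p : ℕ → ℂ} {L : ℂ} {B ρ R : ℝ}
    (hp : Tendsto p atTop (𝓝 L)) (hL : L ≠ 0) (hB : ∀ m, ‖d m * p m‖ * R ^ m ≤ B)
    (hρ : 0 ≤ ρ) (hρR : ρ < R) : Summable fun m => ‖d m‖ * ρ ^ m := by
  have hR : 0 < R := hρ.trans_lt hρR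
  have hgeom : Summable fun m => B * (‖L‖ / 2)⁻¹ * (ρ / R) ^ m :=
    (summable_geometric_of_lt_one (by positivity) ((div_lt_one hR).2 hρR)).mul_left _
  have hlower : ∀ᶠ m in atTop, ‖L‖ / 2 < ‖p m‖ :=
    hp.norm.eventually_const_lt (half_lt_self (norm_pos_iff.2 hL))
  refine .of_norm_bounded_eventually_nat hgeom (hlower.mono fun m hm => ?_)
  have hL' : 0 < ‖L‖ / 2 := by positivity
  have hd : ‖d m‖ ≤ B * (‖L‖ / 2)⁻¹ / R ^ m := by
    rw [le_div_iff₀ (by positivity), le_mul_inv_iff₀ hL']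
    calc ‖d m‖ * R ^ m * (‖L‖ / 2) ≤ ‖d m‖ * R ^ m * ‖p m‖ := by gcongr
      _ = ‖d m * p m‖ * R ^ m := by rw [norm_mul]; ring
      _ ≤ B := hB m
  rw [Real.norm_of_nonneg (by positivity), div_pow]
  calc ‖d m‖ * ρ ^ m ≤ B * (‖L‖ / 2)⁻¹ / R ^ m * ρ ^ m := by gcongr
    _ = _ := by ring

variable {s t r : ℂ} {u : ℂ → ℂ} {c : ℤ → ℂ} {z : ℂ}

lemma norm_mul_P_mul_pow_le {n : ℤ} {R B : ℝ} {d : ℂ} (hR : 0 < R)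
    (hB : ∀ z ∈ Metric.sphere 0 |R|, ‖u z‖ ≤ B)
    (hd : laurentCoeff u n R = d * laurentCoeff (weightSolution s t r n) n R) :
    ‖d * P (r + s * n.toNat + t * (-n).toNat) (s + t) (n.natAbs + 1) (R ^ 2)‖ * R ^ n.natAbs ≤
      B := by
  have hbound := norm_laurentCoeff_le hB n
  rw [hd, laurentCoeff_weightSolution hR.ne', ← mul_assoc, norm_mul, norm_pow, Complex.norm_real,
    Real.norm_of_nonneg hR.le, abs_of_pos hR, zpow_neg, ← div_eq_inv_mul,
    le_div_iff₀ (by positivity), mul_assoc] at hbound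
  have hpow : R ^ (2 * (-n).toNat) * R ^ n = R ^ n.natAbs := by
    rw [← zpow_natCast, ← zpow_natCast, ← zpow_add₀ hR.ne']
    congr 1
    lia
  rwa [hpow] at hbound

lemma summable_norm_mul_pow_natAbs (hu : ContinuousOn u disc)
    (hc : ∀ n, ∀ ρ ∈ Ioo (0 : ℝ) 1,
      laurentCoeff u n ρ = c n * laurentCoeff (weightSolution s t r n) n ρ)
    {ρ : ℝ} (h0 : 0 < ρ) (h1 : ρ < 1) : Summable fun n : ℤ => ‖c n‖ * ρ ^ n.natAbs := by
  obtain ⟨R, hρR, hR1⟩ := exists_between h1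
  have hR : R ∈ Ioo (0 : ℝ) 1 := ⟨h0.trans hρR, hR1⟩
  obtain ⟨B, hB⟩ := (isCompact_sphere (0 : ℂ) |R|).exists_bound_of_continuousOn
    (hu.mono (sphere_abs_subset_disc hR))
  have hle (n : ℤ) := norm_mul_P_mul_pow_le hR.1 hB (hc n R hR)
  refine .of_nat_of_neg ?_ ?_
  · refine summable_norm_mul_pow_of_tendsto (B := B) (tendsto_P_add_mul_atTop r s (s + t) (R ^ 2))
      (Complex.exp_ne_zero _) (fun m => ?_) h0.le hρR
    simpa using hle m
  · simp only [Int.natAbs_neg, Int.natAbs_natCast]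
    refine summable_norm_mul_pow_of_tendsto (B := B) (tendsto_P_add_mul_atTop r t (s + t) (R ^ 2))
      (Complex.exp_ne_zero _) (fun m => ?_) h0.le hρR
    simpa using hle (-m)

lemma eqOn_biseries_of_laurentCoeff_eq (hu : ContinuousOn u disc)
    (hc : ∀ n, ∀ ρ ∈ Ioo (0 : ℝ) 1,
      laurentCoeff u n ρ = c n * laurentCoeff (weightSolution s t r n) n ρ) :
    EqOn u (biseries (fun i : ℤ × ℕ => c i.1 * weightCoeff s t r i.1 i.2)
      (fun i => i.1.toNat + i.2) fun i => (-i.1).toNat + i.2) disc := by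
  have h := absConv_mul_weightCoeff (s := s) (t := t) (r := r) (R := 1)
    fun ρ h0 h1 => summable_norm_mul_pow_natAbs hu hc h0 h1
  have hterm (n : ℤ) {z : ℂ} (hz : z ∈ disc) (hz0 : z ≠ 0) :
      laurentCoeff u n ‖z‖ * z ^ n = biseries (fun k => c n * weightCoeff s t r n k)
        (fun k => n.toNat + k) (fun k => (-n).toNat + k) z := by
    rw [biseries_const_mul, ← weightSolution_eq_biseries,
      ← laurentCoeff_weightSolution_mul_zpow hz0,
      hc n _ ⟨norm_pos_iff.2 hz0, mem_ball_zero_iff.1 hz⟩, mul_assoc]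
  have hne : EqOn u (biseries (fun i : ℤ × ℕ => c i.1 * weightCoeff s t r i.1 i.2)
      (fun i => i.1.toNat + i.2) fun i => (-i.1).toNat + i.2) (disc ∩ {0}ᶜ) := by
    rintro z ⟨hz, hz0⟩
    have hnorm : ‖((‖z‖ : ℝ) : ℂ)‖ = ‖z‖ := by simp
    have hsum : Summable fun n : ℤ => laurentCoeff u n ‖z‖ * (‖z‖ : ℂ) ^ n := by
      have hz' : ((‖z‖ : ℝ) : ℂ) ∈ disc := by
        rw [disc, mem_ball_zero_iff, hnorm]
        exact mem_ball_zero_iff.1 hz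
      refine (h.hasSum_prod hz').summable.congr fun n => ?_
      rw [← hterm n hz' (by simpa using hz0), hnorm]
    have hρ : ‖z‖ ∈ Ioo (0 : ℝ) 1 := ⟨norm_pos_iff.2 hz0, mem_ball_zero_iff.1 hz⟩
    refine (hasSum_laurentCoeff_mul_zpow hρ.1.ne' (hu.mono (sphere_abs_subset_disc hρ)) hsum
      (by simp)).unique ((h.hasSum_prod hz).congr_fun fun n => hterm n hz hz0)
  refine hne.of_subset_closure hu h.contDiffOn.continuousOn inter_subset_left ?_
  exact (dense_compl_singleton (0 : ℂ)).open_subset_closure_inter Metric.isOpen_ball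

/-- The Taylor coefficient `∂^{n⁺} ∂̄^{n⁻} u(0) / (n⁺! n⁻!)`, where `n⁺` and `n⁻` are the positive
and negative parts of `n`: it is the coefficient of the solution of weight `n` in the expansion. -/
def weightTaylorCoeff (u : ℂ → ℂ) (n : ℤ) : ℂ :=
  dz^[n.toNat] (dzbar^[(-n).toNat] u) 0 / (n.toNat ! * (-n).toNat !)

lemma eq_weightTaylorCoeff (h : AbsConv 1 (fun i : ℤ × ℕ => c i.1 * weightCoeff s t r i.1 i.2)
      (fun i => i.1.toNat + i.2) fun i => (-i.1).toNat + i.2)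
    (hu : EqOn u (biseries (fun i : ℤ × ℕ => c i.1 * weightCoeff s t r i.1 i.2)
      (fun i => i.1.toNat + i.2) fun i => (-i.1).toNat + i.2) disc) (n : ℤ) :
    c n = weightTaylorCoeff u n := by
  have hderiv := h.iterate_dz_iterate_dzbar_zero one_pos (n, 0) fun i hi h =>
    hi (Prod.ext (by lia) (by lia))
  simp only [add_zero] at hderiv
  have h0 : weightCoeff s t r n 0 = 1 := by simp [weightCoeff, poch]
  have hpos : (n.toNat ! : ℂ) ≠ 0 := mod_cast n.toNat.factorial_ne_zero
  have hneg : ((-n).toNat ! : ℂ) ≠ 0 := mod_cast (-n).toNat.factorial_ne_zero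
  rw [weightTaylorCoeff, iterate_dz_eqOn Metric.isOpen_ball
    (iterate_dzbar_eqOn Metric.isOpen_ball hu _) _ (Metric.mem_ball_self one_pos), hderiv, h0]
  field_simp

/-- The term of weight `n` of the expansion of `u`: both `holTerm` and `antiholTerm` are of this
form. -/
def weightTerm (s t r : ℂ) (u : ℂ → ℂ) (n : ℤ) (z : ℂ) : ℂ :=
  weightTaylorCoeff u n * weightSolution s t r n z

lemma holTerm_eq_weightTerm (s t r : ℂ) (u : ℂ → ℂ) (m : ℕ) :
    holTerm s t r u m = weightTerm s t r u m := by
  ext z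
  simp only [holTerm, weightTerm, weightTaylorCoeff, weightSolution, Int.toNat_natCast,
    Int.toNat_neg_natCast, Int.natAbs_natCast, Function.iterate_zero, id_eq, Nat.factorial_zero,
    Nat.cast_zero, Nat.cast_one, pow_zero, mul_zero, mul_one, add_zero]
  ring

lemma antiholTerm_eq_weightTerm (s t r : ℂ) (u : ℂ → ℂ) (m : ℕ) :
    antiholTerm s t r u m = weightTerm s t r u (-m) := by
  ext z
  simp only [antiholTerm, weightTerm, weightTaylorCoeff, weightSolution, add_comm t s, neg_neg,
    Int.toNat_natCast, Int.toNat_neg_natCast, Int.natAbs_neg, Int.natAbs_natCast,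
    Function.iterate_zero, id_eq, Nat.factorial_zero, Nat.cast_zero, Nat.cast_one, pow_zero,
    mul_zero, mul_one, one_mul, add_zero]
  ring

lemma weightTerm_eq_biseries (s t r : ℂ) (u : ℂ → ℂ) (n : ℤ) :
    weightTerm s t r u n =
      biseries (fun k => weightTaylorCoeff u n * weightCoeff s t r n k) (fun k => n.toNat + k)
        fun k => (-n).toNat + k := by
  ext z
  rw [biseries_const_mul, ← weightSolution_eq_biseries, weightTerm]

namespace IsSolution

variable (hu : IsSolution s t r u)
include hu

lemma absConv_and_eqOn_biseries :
    AbsConv 1 (fun i : ℤ × ℕ => weightTaylorCoeff u i.1 * weightCoeff s t r i.1 i.2)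
      (fun i => i.1.toNat + i.2) (fun i => (-i.1).toNat + i.2) ∧
    EqOn u (biseries (fun i : ℤ × ℕ => weightTaylorCoeff u i.1 * weightCoeff s t r i.1 i.2)
      (fun i => i.1.toNat + i.2) fun i => (-i.1).toNat + i.2) disc := by
  choose c hc using fun n => hu.exists_laurentCoeff_eq_mul (isSolution_weightSolution s t r n) n
    (exists_laurentCoeff_weightSolution_ne_zero s t r n)
  have hcont := hu.contDiffOn.continuousOn
  have habs := absConv_mul_weightCoeff (s := s) (t := t) (r := r) (R := 1)
    fun ρ h0 h1 => summable_norm_mul_pow_natAbs hcont hc h0 h1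
  have heq := eqOn_biseries_of_laurentCoeff_eq hcont hc
  obtain rfl : c = weightTaylorCoeff u := funext (eq_weightTaylorCoeff habs heq)
  exact ⟨habs, heq⟩

lemma contDiffOn_infty : ContDiffOn ℝ ∞ u disc :=
  hu.absConv_and_eqOn_biseries.1.contDiffOn.congr hu.absConv_and_eqOn_biseries.2

lemma hasSum_weightTerm (hz : z ∈ disc) : HasSum (fun n => weightTerm s t r u n z) (u z) := by
  obtain ⟨habs, heq⟩ := hu.absConv_and_eqOn_biseries
  simp only [weightTerm_eq_biseries, heq hz]
  exact habs.hasSum_prod hz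

lemma summable_seminormOn_weightTerm {K : Set ℂ} (hK : IsCompact K) (hKd : K ⊆ disc) (j k : ℕ) :
    Summable fun n => seminormOn j k K (weightTerm s t r u n) :=
  hu.absConv_and_eqOn_biseries.1.summable_seminormOn (f := weightTerm s t r u)
    (fun n _ _ => congrFun (weightTerm_eq_biseries s t r u n) _) one_pos hK hKd j k

lemma summable_seminormOn_holTerm {K : Set ℂ} (hK : IsCompact K) (hKd : K ⊆ disc) (j k : ℕ) :
    Summable fun m => seminormOn j k K (holTerm s t r u m) := by
  simp only [holTerm_eq_weightTerm]
  exact (hu.summable_seminormOn_weightTerm hK hKd j k).comp_injective Nat.cast_injective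

lemma summable_seminormOn_antiholTerm {K : Set ℂ} (hK : IsCompact K) (hKd : K ⊆ disc) (j k : ℕ) :
    Summable fun m => seminormOn j k K (antiholTerm s t r u m) := by
  simp only [antiholTerm_eq_weightTerm]
  exact (hu.summable_seminormOn_weightTerm hK hKd j k).comp_injective
    (neg_injective.comp Nat.cast_injective)

lemma summable_holTerm (hz : z ∈ disc) : Summable fun m => holTerm s t r u m z := by
  simp only [holTerm_eq_weightTerm]
  exact (hu.hasSum_weightTerm hz).summable.comp_injective Nat.cast_injective

lemma summable_antiholTerm (hz : z ∈ disc) : Summable fun m => antiholTerm s t r u m z := by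
  simp only [antiholTerm_eq_weightTerm]
  exact (hu.hasSum_weightTerm hz).summable.comp_injective
    (neg_injective.comp Nat.cast_injective)

lemma eq_tsum_holTerm_add_tsum_antiholTerm (hz : z ∈ disc) :
    u z = (∑' m, holTerm s t r u m z) + ∑' m, antiholTerm s t r u (m + 1) z := by
  have hpos := hu.summable_holTerm hz
  have hneg := (summable_nat_add_iff 1).2 (hu.summable_antiholTerm hz)
  rw [← (hu.hasSum_weightTerm hz).tsum_eq]
  simp only [holTerm_eq_weightTerm, antiholTerm_eq_weightTerm, Nat.cast_add_one] at hpos hneg ⊢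
  exact tsum_of_nat_of_neg_add_one (f := fun n => weightTerm s t r u n z) hpos hneg

end IsSolution

end Expansion

section Helmholtz

/-! ### The Helmholtz and Laplace equations -/

section IntProd

variable {E ι : Type*} [NormedAddCommGroup E] [CompleteSpace E] {f : ℤ × ι → E} {a : E}

lemma summable_pos_prod (hf : Summable f) :
    Summable fun p : ℕ × ι => f (p.1 + 1, p.2) :=
  hf.comp_injective (i := fun p : ℕ × ι => ((p.1 + 1 : ℤ), p.2)) fun p q h => by
    simpa [Prod.ext_iff] using h

lemma summable_neg_prod (hf : Summable f) :
    Summable fun p : ℕ × ι => f (-(p.1 + 1), p.2) :=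
  hf.comp_injective (i := fun p : ℕ × ι => (-(p.1 + 1 : ℤ), p.2)) fun p q h => by
    simpa [Prod.ext_iff] using h

lemma eq_tsum_tsum_add_tsum_of_hasSum (hf : HasSum f a) :
    a = (∑' (m : ℕ) (i : ι), (f (m + 1, i) + f (-(m + 1), i))) + ∑' i, f (0, i) := by
  have hpos := summable_pos_prod hf.summable
  have hneg := summable_neg_prod hf.summable
  have hpair (m : ℕ) : ∑' i, (f (m + 1, i) + f (-(m + 1), i)) =
      (∑' i, f (m + 1, i)) + ∑' i, f (-(m + 1), i) :=
    (hpos.prod_factor m).tsum_add (hneg.prod_factor m)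
  rw [tsum_congr hpair, hpos.prod.tsum_add hneg.prod, ← hf.tsum_eq, hf.summable.tsum_prod,
    tsum_of_add_one_of_neg_add_one (f := fun n => ∑' i, f (n, i)) hpos.prod hneg.prod]
  abel

end IntProd

/-- The monomial of bidegree `(n⁺ + k, n⁻ + k)` of the expansion of `u`, for `i = (n, k)`. -/
def monomialTerm (s t r : ℂ) (u : ℂ → ℂ) (z : ℂ) (i : ℤ × ℕ) : ℂ :=
  weightTaylorCoeff u i.1 * weightCoeff s t r i.1 i.2 * z ^ (i.1.toNat + i.2) *
    conj z ^ ((-i.1).toNat + i.2)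

lemma poch_natCast_add_one_one_mul_factorial (m k : ℕ) :
    poch (m + 1) 1 k * (m ! : ℂ) = ((m + k)! : ℂ) := by
  induction k with
  | zero => simp [poch]
  | succ k ih =>
    rw [poch_succ, mul_right_comm, ih, ← add_assoc, Nat.factorial_succ]
    push_cast
    ring

lemma weightCoeff_zero_zero (r : ℂ) (n : ℤ) (k : ℕ) :
    weightCoeff 0 0 r n k = n.natAbs ! / ((n.natAbs + k)! : ℂ) * (r ^ k / (k ! : ℂ)) := by
  have hn : (n.natAbs ! : ℂ) ≠ 0 := mod_cast n.natAbs.factorial_ne_zero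
  have hr : poch (r + 0 * n.toNat + 0 * (-n).toNat) (0 + 0) k = r ^ k := by simp [poch]
  rw [weightCoeff, hr, ← poch_natCast_add_one_one_mul_factorial]
  field_simp

lemma norm_pow_two_mul (z : ℂ) (k : ℕ) : (‖z‖ : ℂ) ^ (2 * k) = z ^ k * conj z ^ k := by
  rw [pow_mul, ← Complex.mul_conj', mul_pow]

variable {r : ℂ} {u : ℂ → ℂ} {z : ℂ}

lemma monomialTerm_helmholtz_pos (r : ℂ) (u : ℂ → ℂ) (z : ℂ) (m k : ℕ) :
    monomialTerm 0 0 r u z (m, k) =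
      z ^ m * dz^[m] u 0 / ((m + k)! : ℂ) * (r ^ k * (‖z‖ : ℂ) ^ (2 * k) / (k ! : ℂ)) := by
  have hm : (m ! : ℂ) ≠ 0 := mod_cast m.factorial_ne_zero
  rw [monomialTerm, weightTaylorCoeff, weightCoeff_zero_zero, norm_pow_two_mul]
  simp only [Int.toNat_natCast, Int.toNat_neg_natCast, Int.natAbs_natCast, Function.iterate_zero,
    id_eq, Nat.factorial_zero, Nat.cast_one, mul_one, zero_add, pow_add]
  field_simp

lemma monomialTerm_helmholtz_neg (r : ℂ) (u : ℂ → ℂ) (z : ℂ) (m k : ℕ) :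
    monomialTerm 0 0 r u z (-m, k) =
      conj z ^ m * dzbar^[m] u 0 / ((m + k)! : ℂ) *
        (r ^ k * (‖z‖ : ℂ) ^ (2 * k) / (k ! : ℂ)) := by
  have hm : (m ! : ℂ) ≠ 0 := mod_cast m.factorial_ne_zero
  rw [monomialTerm, weightTaylorCoeff, weightCoeff_zero_zero, norm_pow_two_mul]
  simp only [Int.toNat_natCast, Int.toNat_neg_natCast, Int.natAbs_natCast, Int.natAbs_neg, neg_neg,
    Function.iterate_zero, id_eq, Nat.factorial_zero, Nat.cast_one, one_mul, zero_add, pow_add]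
  field_simp

lemma monomialTerm_helmholtz_add_neg (r : ℂ) (u : ℂ → ℂ) (z : ℂ) (m k : ℕ) :
    monomialTerm 0 0 r u z (m + 1, k) + monomialTerm 0 0 r u z (-(m + 1), k) =
      (z ^ (m + 1) * dz^[m + 1] u 0 + conj z ^ (m + 1) * dzbar^[m + 1] u 0) /
        ((m + 1 + k)! : ℂ) * (r ^ k * (‖z‖ : ℂ) ^ (2 * k) / (k ! : ℂ)) := by
  rw [← Nat.cast_add_one, monomialTerm_helmholtz_pos, monomialTerm_helmholtz_neg, ← add_mul,
    add_div]

lemma monomialTerm_helmholtz_zero (r : ℂ) (u : ℂ → ℂ) (z : ℂ) (k : ℕ) :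
    monomialTerm 0 0 r u z (0, k) =
      u 0 / (k ! : ℂ) * (r ^ k * (‖z‖ : ℂ) ^ (2 * k) / (k ! : ℂ)) := by
  simpa using monomialTerm_helmholtz_pos r u z 0 k

namespace IsSolution

lemma hasSum_monomialTerm {s t : ℂ} (hu : IsSolution s t r u) (hz : z ∈ disc) :
    HasSum (monomialTerm s t r u z) (u z) := by
  obtain ⟨habs, heq⟩ := hu.absConv_and_eqOn_biseries
  rw [heq hz]
  exact (habs.summable hz).hasSum

lemma helmholtz (hu : IsSolution 0 0 r u) (hz : z ∈ disc) :
    Summable (fun p : ℕ × ℕ =>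
      (z ^ (p.1 + 1) * dz^[p.1 + 1] u 0 + conj z ^ (p.1 + 1) * dzbar^[p.1 + 1] u 0) /
        ((p.1 + 1 + p.2)! : ℂ) * (r ^ p.2 * (‖z‖ : ℂ) ^ (2 * p.2) / (p.2 ! : ℂ))) ∧
    Summable (fun n : ℕ => u 0 / (n ! : ℂ) * (r ^ n * (‖z‖ : ℂ) ^ (2 * n) / (n ! : ℂ))) ∧
    u z = (∑' m : ℕ, ∑' n : ℕ,
        (z ^ (m + 1) * dz^[m + 1] u 0 + conj z ^ (m + 1) * dzbar^[m + 1] u 0) /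
          ((m + 1 + n)! : ℂ) * (r ^ n * (‖z‖ : ℂ) ^ (2 * n) / (n ! : ℂ))) +
      ∑' n : ℕ, u 0 / (n ! : ℂ) * (r ^ n * (‖z‖ : ℂ) ^ (2 * n) / (n ! : ℂ)) := by
  have h := hu.hasSum_monomialTerm hz
  simp only [← monomialTerm_helmholtz_add_neg, ← monomialTerm_helmholtz_zero]
  exact ⟨(summable_pos_prod h.summable).add (summable_neg_prod h.summable),
    h.summable.prod_factor 0, eq_tsum_tsum_add_tsum_of_hasSum h⟩

lemma laplace (hu : IsSolution 0 0 0 u) (hz : z ∈ disc) :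
    Summable (fun m : ℕ =>
      (z ^ (m + 1) * dz^[m + 1] u 0 + conj z ^ (m + 1) * dzbar^[m + 1] u 0) / ((m + 1)! : ℂ)) ∧
    u z = (∑' m : ℕ,
        (z ^ (m + 1) * dz^[m + 1] u 0 + conj z ^ (m + 1) * dzbar^[m + 1] u 0) /
          ((m + 1)! : ℂ)) + u 0 := by
  obtain ⟨hsum, -, heq⟩ := hu.helmholtz hz
  have hsingle (A : ℂ) (q : ℕ → ℕ) :
      ∑' n : ℕ, A / ((q n)! : ℂ) * (0 ^ n * (‖z‖ : ℂ) ^ (2 * n) / (n ! : ℂ)) =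
        A / ((q 0)! : ℂ) := by
    rw [tsum_eq_single 0 fun n hn => by simp [hn]]
    simp
  rw [hsingle _ fun n => n, tsum_congr fun m => hsingle _ fun n => m + 1 + n] at heq
  refine ⟨?_, by simpa using heq⟩
  simpa [Function.comp_def] using hsum.comp_injective (Prod.mk_left_injective 0)

end IsSolution

end Helmholtz

end GenHarmonic

end

open GenHarmonic in
theorem mainTheorem2 (s t r : ℂ) (u : ℂ → ℂ) (hu : IsSolution s t r u) :
    -- `u` is smooth, so that all its derivatives at the origin exist
    ContDiffOn ℝ ∞ u disc ∧
    -- the expansion converges absolutely in `C^∞` of the disc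
    (∀ (j k : ℕ) (K : Set ℂ), IsCompact K → K ⊆ disc →
      Summable (fun m : ℕ => seminormOn j k K (holTerm s t r u m)) ∧
      Summable (fun m : ℕ => seminormOn j k K (antiholTerm s t r u (m + 1)))) ∧
    -- and its sum is `u`
    (∀ z ∈ disc,
      Summable (fun m : ℕ => ‖holTerm s t r u m z‖) ∧
      Summable (fun m : ℕ => ‖antiholTerm s t r u (m + 1) z‖) ∧
      u z = (∑' m : ℕ, holTerm s t r u m z) + (∑' m : ℕ, antiholTerm s t r u (m + 1) z)) ∧
    -- the Helmholtz equation `∂∂̄u - r u = 0`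
    (s = 0 → t = 0 → ∀ z ∈ disc,
      Summable (fun p : ℕ × ℕ =>
        (z ^ (p.1 + 1) * dz^[p.1 + 1] u 0 + (conj z) ^ (p.1 + 1) * dzbar^[p.1 + 1] u 0)
          / ((p.1 + 1 + p.2)! : ℂ) * (r ^ p.2 * (‖z‖ : ℂ) ^ (2 * p.2) / (p.2 ! : ℂ))) ∧
      Summable (fun n : ℕ =>
        u 0 / (n ! : ℂ) * (r ^ n * (‖z‖ : ℂ) ^ (2 * n) / (n ! : ℂ))) ∧
      u z = (∑' m : ℕ, ∑' n : ℕ,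
          (z ^ (m + 1) * dz^[m + 1] u 0 + (conj z) ^ (m + 1) * dzbar^[m + 1] u 0)
            / ((m + 1 + n)! : ℂ) * (r ^ n * (‖z‖ : ℂ) ^ (2 * n) / (n ! : ℂ)))
        + ∑' n : ℕ, u 0 / (n ! : ℂ) * (r ^ n * (‖z‖ : ℂ) ^ (2 * n) / (n ! : ℂ))) ∧
    -- the Laplace equation `∂∂̄u = 0`
    (s = 0 → t = 0 → r = 0 → ∀ z ∈ disc,
      Summable (fun m : ℕ =>
        (z ^ (m + 1) * dz^[m + 1] u 0 + (conj z) ^ (m + 1) * dzbar^[m + 1] u 0)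
          / ((m + 1)! : ℂ)) ∧
      u z = (∑' m : ℕ,
          (z ^ (m + 1) * dz^[m + 1] u 0 + (conj z) ^ (m + 1) * dzbar^[m + 1] u 0)
            / ((m + 1)! : ℂ))
        + u 0) := by
  refine ⟨hu.contDiffOn_infty, fun j k K hK hKd => ?_, fun z hz => ?_, ?_, ?_⟩
  · exact ⟨hu.summable_seminormOn_holTerm hK hKd j k,
      (summable_nat_add_iff 1).2 (hu.summable_seminormOn_antiholTerm hK hKd j k)⟩
  · exact ⟨(hu.summable_holTerm hz).norm,
      ((summable_nat_add_iff 1).2 (hu.summable_antiholTerm hz)).norm,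
      hu.eq_tsum_holTerm_add_tsum_antiholTerm hz⟩
  · rintro rfl rfl z hz
    exact hu.helmholtz hz
  · rintro rfl rfl rfl z hz
    exact hu.laplace hz
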